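/- Let $g,n\ge 0$ be integers with $2g-2+n>0$ and write $[n]=\{1,\dots,n\}$. **Graphs.** A graph has a finite set of vertices, a finite set of half-edges, a map attaching each half-edge to a vertex, and a fixed point free involution on the half-edges, whose orbits are the edges. An $n$-marked graph is a graph $\Gamma$ with a genus $g(v)\in\mathbb N$ for each vertex $v$ and a map $p\colon[n]\to\mathrm{Vert}(\Gamma)$. It is stable if it is connected and, for each vertex of genus $0$, the number of half-edges at it plus the number of markings on it is at least $3$. Its genus is $\sum_v g(v)-\#\mathrm{Vert}+\#\mathrm{Edge}+1$. Isomorphisms are pairs of bijections on vertices and half-edges respecting all the structure. Let $G_{g,n}$ be a set of representatives of the isomorphism classes of stable $n$-marked graphs of genus $g$. A contraction $c\colon\Gamma_1\to\Gamma_2$ is the choice of an edge of $\Gamma_1$ and of an isomorphism to $\Gamma_2$ from the graph obtained from $\Gamma_1$ by removing that edge and identifying its endpoints to one vertex, which inherits their markings and whose genus is the sum of the genera of the two endpoints (or the genus of the endpoint plus $1$ if the edge is a loop). **Stability spaces.** For a graph $\Gamma$ let $V(\Gamma)=\mathbb R^{\mathrm{Vert}(\Gamma)}$ and $V^0(\Gamma)=\{\phi\in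 V(\Gamma):\sum_v\phi(v)=0\}$. Let $V_{g,n}\subseteq\prod_{\Gamma\in G_{g,n}}V(\Gamma)$ be the subspace of those $\phi$ such that $\phi(\Gamma)$ is invariant under all automorphisms of $\Gamma$, for every $\Gamma$, and $\phi(\Gamma_2)(v_2)=\sum_{c(v_1)=v_2}\phi(\Gamma_1)(v_1)$ for every contraction $c\colon\Gamma_1\to\Gamma_2$ and every vertex $v_2$ of $\Gamma_2$. For $d\in\mathbb R$ let $V^d_{g,n}\subseteq V_{g,n}$ be the affine subspace of those $\phi$ with $\sum_v\phi(\Gamma)(v)=d$ for all $\Gamma$. The canonical parameter $\phi^d_{\mathrm{can}}\in V^d_{g,n}$ is $\frac{d}{2g-2}$ times the multidegree of the relative dualizing sheaf, i.e. $\phi^d_{\mathrm{can}}(\Gamma)(v)=\frac{d}{2g-2}\,(2g(v)-2+\mathrm{val}(v))$, if $g\ge2$ (where $\mathrm{val}(v)$ is the number of half-edges at $v$), and $d$ times the multidegree of the first section, i.e. $\phi^d_{\mathrm{can}}(\Gamma)(v)=d$ if $v=p(1)$ and $0$ otherwise, if $g\le1$. **Special graphs.** Consider the pairs $(i,S)$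 with $0\le i\le g$, $S\subseteq[n]$, such that $|S|\ge2$ if $i=0$, $|S|\le n-2$ if $i=g$, $1\in S$ if $n\ge1$, and $i<g-i$ if $n=0$. For such a pair let $\Gamma(i,S)\in G_{g,n}$ be the graph with two vertices, of genera $i$ and $g-i$ and with markings $S$ and $[n]\setminus S$ respectively, joined by one edge. Let $\delta_{1,g}=1$ if $g=1$ and $0$ otherwise. If $g\ge1$, then for $j=1+\delta_{1,g},\dots,n$ let $\Gamma_j\in G_{g,n}$ be the graph with two vertices, of genera $0$ and $g-1$, joined by two edges, with marking $j$ on the first vertex and all other markings on the second. Let $T_{g,n}$ be the direct sum of the spaces $V^0(\Gamma)$ over the $\Gamma\in G_{g,n}$ with two vertices and no loops, let $$C_{g,n}=\bigoplus_{(i,S)}V^0(\Gamma(i,S)),\qquad D_{g,n}=\bigoplus_{j}V^0(\Gamma_j)$$ (so $D_{0,n}=0$), and let $p_C\colon T_{g,n}\to C_{g,n}$ and $p_D\colon T_{g,n}\to D_{g,n}$ be the projections. Let $\rho^d\colon V^d_{g,n}\to T_{g,n}$ send $\phi$ to the restriction of $\phi-\phi^d_{\mathrm{can}}$ to the graphs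 with two vertices and no loops. **Corollary.** 1. For every $d\in\mathbb R$ the map $$(p_C\oplus p_D)\circ\rho^d\colon V^d_{g,n}\longrightarrow C_{g,n}\oplus D_{g,n}$$ is an isomorphism: it is an isomorphism of affine spaces sending $\phi^d_{\mathrm{can}}$ to $0$, hence an isomorphism of vector spaces when $\phi^d_{\mathrm{can}}$ is taken as the origin of $V^d_{g,n}$. 2. Hence, for every $d\in\mathbb R$, two elements of $V^d_{g,n}$ that have the same components at all the graphs $\Gamma(i,S)$ and $\Gamma_j$ are equal. 3. Let $g\ge2$, $n\ge1$, and let $N$ be the number of boundary divisors of $\overline{\mathcal M}_{g,n}$, that is, the number of $\Gamma\in G_{g,n}$ with exactly one edge. Then there are exactly $N-1$ pairs $(i,S)$, and $$V^{g-1}_{g,n}\cong\mathbb R^{N-1}\times\mathbb R^n$$ as affine spaces, through the coordinates $(\alpha_{i,S})_{(i,S)}$ and $(x_j)_{1\le j\le n}$, where $\alpha_{i,S}$ is the value of $\phi-\phi^{g-1}_{\mathrm{can}}$ at the vertex of $\Gamma(i,S)$ with genus $i$ and markings $S$, and $x_j$ is its value at the vertex of $\Gamma_j$ of genus $0$ carrying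 marking $j$. -/

import Mathlib

namespace UniversalStability

/-- An `n`-marked graph: finite sets of vertices and half-edges, the map `a` sending a half-edge to
the vertex it is attached to, a fixed point free involution `i` of the half-edges (whose orbits are
the edges), a genus for every vertex, and a vertex for every marking.  The markings `1, …, n` are
the elements `0, …, n - 1` of `Fin n`. -/
structure MarkedGraph (n : ℕ) where
  Vert : Type
  HalfEdge : Type
  fintypeVert : Fintype Vert
  fintypeHalfEdge : Fintype HalfEdge
  a : HalfEdge → Vert
  i : HalfEdge → HalfEdge
  i_i : ∀ h, i (i h) = h
  i_ne : ∀ h, i h ≠ h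
  genus : Vert → ℕ
  mark : Fin n → Vert

attribute [instance] MarkedGraph.fintypeVert MarkedGraph.fintypeHalfEdge

namespace MarkedGraph

variable {n : ℕ}

/-- Two half-edges define the same edge if they lie in the same orbit of the involution. -/
def edgeSetoid (Γ : MarkedGraph n) : Setoid Γ.HalfEdge where
  r h k := h = k ∨ Γ.i h = k
  iseqv :=
    { refl := fun _ => Or.inl rfl
      symm := by
        rintro h k (rfl | rfl)
        · exact Or.inl rfl
        · exact Or.inr (Γ.i_i h)
      trans := by
        rintro h k l (rfl | rfl) (rfl | rfl)
        · exact Or.inl rfl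
        · exact Or.inr rfl
        · exact Or.inr rfl
        · exact Or.inl (Γ.i_i h).symm }

/-- The set of edges. -/
def Edge (Γ : MarkedGraph n) : Type := Quotient Γ.edgeSetoid

/-- The number of half-edges attached to a vertex (a loop counts twice). -/
noncomputable def valence (Γ : MarkedGraph n) (v : Γ.Vert) : ℕ := Nat.card {h // Γ.a h = v}

/-- The number of markings on a vertex. -/
noncomputable def numMarks (Γ : MarkedGraph n) (v : Γ.Vert) : ℕ := Nat.card {j // Γ.mark j = v}

/-- Two vertices are adjacent if they are the endpoints of an edge. -/
def Adj (Γ : MarkedGraph n) (v w : Γ.Vert) : Prop := ∃ h, Γ.a h = v ∧ Γ.a (Γ.i h) = w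

def IsConnected (Γ : MarkedGraph n) : Prop :=
  Nonempty Γ.Vert ∧ ∀ v w, Relation.ReflTransGen Γ.Adj v w

def IsStable (Γ : MarkedGraph n) : Prop :=
  Γ.IsConnected ∧ ∀ v, Γ.genus v = 0 → 3 ≤ Γ.valence v + Γ.numMarks v

/-- The arithmetic genus. -/
noncomputable def arithGenus (Γ : MarkedGraph n) : ℤ :=
  (∑ v, (Γ.genus v : ℤ)) - Nat.card Γ.Vert + Nat.card Γ.Edge + 1

/-- Isomorphisms of marked graphs. -/
structure Iso (Γ Γ' : MarkedGraph n) where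
  vert : Γ.Vert ≃ Γ'.Vert
  half : Γ.HalfEdge ≃ Γ'.HalfEdge
  a_comm : ∀ h, vert (Γ.a h) = Γ'.a (half h)
  i_comm : ∀ h, half (Γ.i h) = Γ'.i (half h)
  genus_comm : ∀ v, Γ'.genus (vert v) = Γ.genus v
  mark_comm : ∀ j, vert (Γ.mark j) = Γ'.mark j

def Iso.refl (Γ : MarkedGraph n) : Iso Γ Γ where
  vert := Equiv.refl _
  half := Equiv.refl _
  a_comm _ := rfl
  i_comm _ := rfl
  genus_comm _ := rfl
  mark_comm _ := rfl

def Iso.symm {Γ Γ' : MarkedGraph n} (f : Iso Γ Γ') : Iso Γ' Γ where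
  vert := f.vert.symm
  half := f.half.symm
  a_comm h := by rw [Equiv.symm_apply_eq, f.a_comm, Equiv.apply_symm_apply]
  i_comm h := by rw [Equiv.symm_apply_eq, f.i_comm, Equiv.apply_symm_apply]
  genus_comm v := by rw [← f.genus_comm, Equiv.apply_symm_apply]
  mark_comm j := by rw [Equiv.symm_apply_eq, f.mark_comm]

def Iso.trans {Γ Γ' Γ'' : MarkedGraph n} (f : Iso Γ Γ') (f' : Iso Γ' Γ'') : Iso Γ Γ'' where
  vert := f.vert.trans f'.vert
  half := f.half.trans f'.half
  a_comm h := by simp [f.a_comm, f'.a_comm]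
  i_comm h := by simp [f.i_comm, f'.i_comm]
  genus_comm v := by simp [f.genus_comm, f'.genus_comm]
  mark_comm j := by simp [f.mark_comm, f'.mark_comm]

/-- The vertex `v` is one of the two (possibly coinciding) endpoints of the edge `{h, i h}`. -/
def IsEnd (Γ : MarkedGraph n) (h : Γ.HalfEdge) (v : Γ.Vert) : Prop :=
  v = Γ.a h ∨ v = Γ.a (Γ.i h)

/-- The relation that identifies the two endpoints of the edge `{h, i h}` with each other. -/
def contractSetoid (Γ : MarkedGraph n) (h : Γ.HalfEdge) : Setoid Γ.Vert where
  r v w := v = w ∨ (Γ.IsEnd h v ∧ Γ.IsEnd h w)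
  iseqv :=
    { refl := fun _ => Or.inl rfl
      symm := by
        rintro v w (rfl | ⟨hv, hw⟩)
        · exact Or.inl rfl
        · exact Or.inr ⟨hw, hv⟩
      trans := by
        rintro u v w (rfl | ⟨hu, hv⟩) (rfl | ⟨hv', hw⟩)
        · exact Or.inl rfl
        · exact Or.inr ⟨hv', hw⟩
        · exact Or.inr ⟨hu, hv⟩
        · exact Or.inr ⟨hu, hw⟩ }

/-- The quotient map from the vertices of `Γ` to those of the contraction of `{h, i h}`. -/
def contractVert (Γ : MarkedGraph n) (h : Γ.HalfEdge) (v : Γ.Vert) :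
    Quotient (Γ.contractSetoid h) := Quotient.mk _ v

open Classical in
/-- The strict contraction of the edge `{h, i h}`: its two half-edges are removed and its endpoints
are replaced by a single vertex, whose genus is the sum of the genera of the two endpoints if the
edge is not a loop, and the genus of the endpoint plus one if the edge is a loop. -/
noncomputable def strictContraction (Γ : MarkedGraph n) (h : Γ.HalfEdge) : MarkedGraph n where
  Vert := Quotient (Γ.contractSetoid h)
  HalfEdge := {k : Γ.HalfEdge // k ≠ h ∧ k ≠ Γ.i h}
  fintypeVert := Fintype.ofFinite _
  fintypeHalfEdge := Fintype.ofFinite _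
  a k := Γ.contractVert h (Γ.a k.1)
  i k := ⟨Γ.i k.1, fun e => k.2.2 (by simpa only [Γ.i_i] using congrArg Γ.i e),
    fun e => k.2.1 (by simpa only [Γ.i_i] using congrArg Γ.i e)⟩
  i_i k := Subtype.ext (Γ.i_i k.1)
  i_ne k e := Γ.i_ne k.1 (congrArg Subtype.val e)
  genus q := (∑ v with Γ.contractVert h v = q, Γ.genus v) +
    if Γ.a h = Γ.a (Γ.i h) ∧ Γ.contractVert h (Γ.a h) = q then 1 else 0
  mark j := Γ.contractVert h (Γ.mark j)

/-- A contraction `Γ → Γ'`: the choice of an edge of `Γ` (through one of its half-edges) and of an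
isomorphism from the strict contraction of that edge to `Γ'`. -/
structure Contraction (Γ Γ' : MarkedGraph n) where
  half : Γ.HalfEdge
  iso : Iso (Γ.strictContraction half) Γ'

/-- The map on vertices induced by a contraction. -/
noncomputable def Contraction.onVert {Γ Γ' : MarkedGraph n} (c : Contraction Γ Γ') (v : Γ.Vert) :
    Γ'.Vert := c.iso.vert (Γ.contractVert c.half v)

/-- The dual graph of a vine curve: two vertices and no loops. -/
def IsVine (Γ : MarkedGraph n) : Prop :=
  Nat.card Γ.Vert = 2 ∧ ∀ h, Γ.a h ≠ Γ.a (Γ.i h)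

/-- `V⁰(Γ)`: the real functions on the vertices with sum zero. -/
def degreeZero (Γ : MarkedGraph n) : Submodule ℝ (Γ.Vert → ℝ) where
  carrier := {φ | ∑ v, φ v = 0}
  add_mem' := by
    intro φ ψ hφ hψ
    simp only [Set.mem_ofPred_eq, Pi.add_apply, Finset.sum_add_distrib] at *
    rw [hφ, hψ, add_zero]
  zero_mem' := by simp
  smul_mem' := by
    intro c φ hφ
    simp only [Set.mem_ofPred_eq, Pi.smul_apply, smul_eq_mul, ← Finset.mul_sum] at *
    rw [hφ, mul_zero]

/-- The degree of the relative dualizing sheaf on the component corresponding to a vertex. -/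
noncomputable def omegaDeg (Γ : MarkedGraph n) (v : Γ.Vert) : ℝ :=
  2 * (Γ.genus v : ℝ) - 2 + Γ.valence v

open Classical in
/-- The degree of the line bundle of the `j`-th section on the component corresponding to a
vertex. -/
noncomputable def sectionDeg (Γ : MarkedGraph n) (j : Fin n) (v : Γ.Vert) : ℝ :=
  if Γ.mark j = v then 1 else 0

end MarkedGraph

open MarkedGraph

/-- Stable `n`-marked graphs of genus `g`. -/
def StableGraph (g n : ℕ) : Type 1 := {Γ : MarkedGraph n // Γ.IsStable ∧ Γ.arithGenus = g}

/-- Isomorphism of stable graphs. -/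
instance isoSetoid (g n : ℕ) : Setoid (StableGraph g n) where
  r Γ Γ' := Nonempty (Iso Γ.1 Γ'.1)
  iseqv :=
    { refl := fun Γ => ⟨Iso.refl Γ.1⟩
      symm := fun ⟨f⟩ => ⟨f.symm⟩
      trans := fun ⟨f⟩ ⟨f'⟩ => ⟨f.trans f'⟩ }

/-- The set `G_{g,n}` of isomorphism classes of stable `n`-marked graphs of genus `g`. -/
abbrev GraphClass (g n : ℕ) : Type 1 := Quotient (isoSetoid g n)

/-- The isomorphism class of a stable graph. -/
def StableGraph.cls {g n : ℕ} (Γ : StableGraph g n) : GraphClass g n := Quotient.mk _ Γ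

/-- The graph that is fixed, once and for all, in every isomorphism class. -/
noncomputable def GraphClass.graph {g n : ℕ} (Γ : GraphClass g n) : MarkedGraph n :=
  (Quotient.out Γ).1

/-- The product of the spaces `V(Γ)` of real functions on the vertices of `Γ`, for `Γ` in
`G_{g,n}`. -/
abbrev Ambient (g n : ℕ) : Type 1 := (Γ : GraphClass g n) → Γ.graph.Vert → ℝ

def AutInvariant {g n : ℕ} (φ : Ambient g n) : Prop :=
  ∀ (Γ : GraphClass g n) (α : Iso Γ.graph Γ.graph) (v : Γ.graph.Vert), φ Γ (α.vert v) = φ Γ v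

open Classical in
def ContractionCompatible {g n : ℕ} (φ : Ambient g n) : Prop :=
  ∀ (Γ₁ Γ₂ : GraphClass g n) (c : Contraction Γ₁.graph Γ₂.graph) (v₂ : Γ₂.graph.Vert),
    φ Γ₂ v₂ = ∑ v₁ with c.onVert v₁ = v₂, φ Γ₁ v₁

/-- The stability space `V_{g,n}`. -/
noncomputable def stabilitySpace (g n : ℕ) : Submodule ℝ (Ambient g n) where
  carrier := {φ | AutInvariant φ ∧ ContractionCompatible φ}
  add_mem' := by
    rintro φ ψ ⟨h1, h2⟩ ⟨h3, h4⟩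
    refine ⟨fun Γ α v => ?_, fun Γ₁ Γ₂ c v => ?_⟩
    · simp only [Pi.add_apply]
      rw [h1, h3]
    · simp only [Pi.add_apply, Finset.sum_add_distrib]
      rw [h2 Γ₁ Γ₂ c, h4 Γ₁ Γ₂ c]
  zero_mem' := ⟨fun _ _ _ => rfl, fun _ _ _ _ => by simp⟩
  smul_mem' := by
    rintro r φ ⟨h1, h2⟩
    refine ⟨fun Γ α v => ?_, fun Γ₁ Γ₂ c v => ?_⟩
    · simp only [Pi.smul_apply]
      rw [h1]
    · simp only [Pi.smul_apply, ← Finset.smul_sum]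
      rw [h2 Γ₁ Γ₂ c]

/-- The affine subspace `V^d_{g,n}` of stability parameters of degree `d`. -/
noncomputable def stabilitySpaceDeg (g n : ℕ) (d : ℝ) : AffineSubspace ℝ (Ambient g n) where
  carrier := {φ | φ ∈ stabilitySpace g n ∧ ∀ Γ : GraphClass g n, ∑ v, φ Γ v = d}
  smul_vsub_vadd_mem' := by
    rintro c φ₁ φ₂ φ₃ ⟨h1, e1⟩ ⟨h2, e2⟩ ⟨h3, e3⟩
    refine ⟨Submodule.add_mem _ (Submodule.smul_mem _ _ (Submodule.sub_mem _ h1 h2)) h3,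
      fun Γ => ?_⟩
    simp only [vsub_eq_sub, vadd_eq_add, Pi.add_apply, Pi.smul_apply, Pi.sub_apply,
      Finset.sum_add_distrib, ← Finset.smul_sum, Finset.sum_sub_distrib, e1, e2, e3]
    simp

/-- The canonical parameter of degree `d`. -/
noncomputable def canonicalParameter (g n : ℕ) [hgn : Fact (2 < 2 * g + n)] (d : ℝ) :
    Ambient g n := fun Γ v =>
  if hg : 2 ≤ g then d / (2 * (g : ℝ) - 2) * Γ.graph.omegaDeg v
  else d * Γ.graph.sectionDeg ⟨0, by have := hgn.out; omega⟩ v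

/-! Facts showing that the canonical parameter lies in `V^d_{g,n}`. -/

namespace MarkedGraph

variable {n : ℕ}

open Classical in
theorem card_edge_fiber (Γ : MarkedGraph n) (e : Quotient Γ.edgeSetoid) :
    (Finset.univ.filter fun h => Quotient.mk Γ.edgeSetoid h = e).card = 2 := by
  induction e using Quotient.inductionOn with
  | h k =>
    rw [Finset.card_eq_two]
    refine ⟨k, Γ.i k, (Γ.i_ne k).symm, ?_⟩
    ext h
    simp only [Finset.mem_filter, Finset.mem_univ, true_and, Finset.mem_insert,
      Finset.mem_singleton]
    constructor
    · intro e
      rcases Quotient.exact e with h' | h'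
      · exact Or.inl h'
      · exact Or.inr (by rw [← h', Γ.i_i])
    · rintro (rfl | rfl)
      · rfl
      · exact Quotient.sound (Or.inr (Γ.i_i k))

theorem card_halfEdge (Γ : MarkedGraph n) : Nat.card Γ.HalfEdge = 2 * Nat.card Γ.Edge := by
  classical
  let _ : Fintype (Quotient Γ.edgeSetoid) := Fintype.ofFinite _
  change _ = 2 * Nat.card (Quotient Γ.edgeSetoid)
  rw [Nat.card_eq_fintype_card, Nat.card_eq_fintype_card, ← Finset.card_univ,
    Finset.card_eq_sum_card_fiberwise (f := Quotient.mk Γ.edgeSetoid)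
      (t := Finset.univ) (fun _ _ => by simp)]
  have e := fun q => Γ.card_edge_fiber q
  have e' : ∀ q ∈ (Finset.univ : Finset (Quotient Γ.edgeSetoid)),
      (Finset.univ.filter fun h => Quotient.mk Γ.edgeSetoid h = q).card = 2 := by
    intro q _
    convert e q
  rw [Finset.sum_congr rfl e', Finset.sum_const, Finset.card_univ, smul_eq_mul, mul_comm]

theorem sum_valence (Γ : MarkedGraph n) : ∑ v, Γ.valence v = Nat.card Γ.HalfEdge := by
  classical
  rw [Nat.card_eq_fintype_card, ← Finset.card_univ,
    Finset.card_eq_sum_card_fiberwise (f := Γ.a) (t := Finset.univ) (fun _ _ => by simp)]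
  refine Finset.sum_congr rfl fun v _ => ?_
  rw [valence, Nat.card_eq_fintype_card, Fintype.card_subtype]

theorem sum_omegaDeg (Γ : MarkedGraph n) : ∑ v, Γ.omegaDeg v = 2 * (Γ.arithGenus : ℝ) - 2 := by
  have h1 : (∑ v, (Γ.valence v : ℝ)) = 2 * Nat.card Γ.Edge := by
    exact_mod_cast Γ.sum_valence.trans Γ.card_halfEdge
  simp only [omegaDeg, arithGenus, Finset.sum_add_distrib, Finset.sum_sub_distrib, h1,
    ← Finset.mul_sum, Finset.sum_const, Finset.card_univ, Nat.card_eq_fintype_card]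
  push_cast
  rw [nsmul_eq_mul]
  ring

theorem sum_sectionDeg (Γ : MarkedGraph n) (j : Fin n) : ∑ v, Γ.sectionDeg j v = 1 := by
  classical
  simp [sectionDeg]

theorem Iso.valence_eq {Γ Γ' : MarkedGraph n} (f : Iso Γ Γ') (v : Γ.Vert) :
    Γ'.valence (f.vert v) = Γ.valence v := by
  refine (Nat.card_congr (f.half.subtypeEquiv fun h => ?_)).symm
  rw [← f.a_comm, f.vert.apply_eq_iff_eq]

theorem Iso.omegaDeg_eq {Γ Γ' : MarkedGraph n} (f : Iso Γ Γ') (v : Γ.Vert) :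
    Γ'.omegaDeg (f.vert v) = Γ.omegaDeg v := by
  simp only [omegaDeg, f.genus_comm, f.valence_eq]

theorem Iso.sectionDeg_eq {Γ Γ' : MarkedGraph n} (f : Iso Γ Γ') (j : Fin n) (v : Γ.Vert) :
    Γ'.sectionDeg j (f.vert v) = Γ.sectionDeg j v := by
  have e : Γ'.mark j = f.vert v ↔ Γ.mark j = v := by
    rw [← f.mark_comm, f.vert.apply_eq_iff_eq]
  unfold sectionDeg
  split_ifs <;> tauto

open Classical in
theorem sectionDeg_contract (Γ : MarkedGraph n) (h : Γ.HalfEdge) (j : Fin n)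
    (q : Quotient (Γ.contractSetoid h)) :
    (Γ.strictContraction h).sectionDeg j q =
      ∑ v with Γ.contractVert h v = q, Γ.sectionDeg j v := by
  simp only [sectionDeg, Finset.sum_ite_eq, Finset.mem_filter, Finset.mem_univ, true_and]
  exact if_congr Iff.rfl rfl rfl

theorem contractVert_eq (Γ : MarkedGraph n) (h : Γ.HalfEdge) (v w : Γ.Vert) :
    Γ.contractVert h v = Γ.contractVert h w ↔ v = w ∨ (Γ.IsEnd h v ∧ Γ.IsEnd h w) :=
  Quotient.eq (r := Γ.contractSetoid h)

open Classical in
theorem card_fiber (Γ : MarkedGraph n) (h : Γ.HalfEdge) (q : Quotient (Γ.contractSetoid h)) :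
    (Finset.univ.filter fun v => Γ.contractVert h v = q).card =
      1 + if Γ.a h ≠ Γ.a (Γ.i h) ∧ Γ.contractVert h (Γ.a h) = q then 1 else 0 := by
  obtain ⟨w, rfl⟩ : ∃ w, Γ.contractVert h w = q := Quotient.exists_rep q
  simp only [contractVert_eq]
  by_cases hw : Γ.IsEnd h w
  · have e1 : (Finset.univ.filter fun v => v = w ∨ Γ.IsEnd h v ∧ Γ.IsEnd h w) =
        {Γ.a h, Γ.a (Γ.i h)} := by
      ext v
      simp only [Finset.mem_filter, Finset.mem_univ, true_and, Finset.mem_insert,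
        Finset.mem_singleton, hw, and_true]
      constructor
      · rintro (rfl | hv)
        · exact hw
        · exact hv
      · exact Or.inr
    have e2 : Γ.IsEnd h (Γ.a h) := Or.inl rfl
    rw [e1]
    by_cases hl : Γ.a h = Γ.a (Γ.i h)
    · simp [hl]
    · simp [hl, hw, e2]
  · have e1 : (Finset.univ.filter fun v => v = w ∨ Γ.IsEnd h v ∧ Γ.IsEnd h w) = {w} := by
      ext v
      simp [hw]
    have e2 : ¬ (Γ.a h = w) := fun e => hw (Or.inl e.symm)
    rw [e1]
    simp [hw, e2]

open Classical in
theorem valence_contract (Γ : MarkedGraph n) (h : Γ.HalfEdge)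
    (q : Quotient (Γ.contractSetoid h)) :
    ((Γ.strictContraction h).valence q : ℤ) + (if Γ.contractVert h (Γ.a h) = q then 2 else 0) =
      ∑ v with Γ.contractVert h v = q, (Γ.valence v : ℤ) := by
  have e0 : ∑ v with Γ.contractVert h v = q, Γ.valence v =
      (Finset.univ.filter fun k => Γ.contractVert h (Γ.a k) = q).card := by
    rw [Finset.card_eq_sum_card_fiberwise (f := Γ.a)
      (t := Finset.univ.filter fun v => Γ.contractVert h v = q) (fun k hk => by simpa using hk)]
    refine Finset.sum_congr rfl fun v hv => ?_
    rw [valence, Nat.card_eq_fintype_card, Fintype.card_subtype, Finset.filter_filter]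
    congr 1
    ext k
    simp only [Finset.mem_filter, Finset.mem_univ, true_and] at hv ⊢
    constructor
    · rintro rfl
      exact ⟨hv, rfl⟩
    · exact fun e => e.2
  have e1 : (Γ.strictContraction h).valence q =
      (Finset.univ.filter fun k => (k ≠ h ∧ k ≠ Γ.i h) ∧ Γ.contractVert h (Γ.a k) = q).card := by
    rw [← Fintype.card_subtype, ← Nat.card_eq_fintype_card]
    exact Nat.card_congr (Equiv.subtypeSubtypeEquivSubtypeInter
      (fun k : Γ.HalfEdge => k ≠ h ∧ k ≠ Γ.i h) fun k => Γ.contractVert h (Γ.a k) = q)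
  have e2 : Γ.contractVert h (Γ.a (Γ.i h)) = Γ.contractVert h (Γ.a h) :=
    (Γ.contractVert_eq h _ _).2 (Or.inr ⟨Or.inr rfl, Or.inl rfl⟩)
  have e3 := Finset.card_filter_add_card_filter_not (s := Finset.univ.filter fun k =>
    Γ.contractVert h (Γ.a k) = q) (fun k => k ≠ h ∧ k ≠ Γ.i h)
  rw [Finset.filter_filter, Finset.filter_filter] at e3
  have e4 : (Finset.univ.filter fun k => Γ.contractVert h (Γ.a k) = q ∧
      ¬ (k ≠ h ∧ k ≠ Γ.i h)).card = if Γ.contractVert h (Γ.a h) = q then 2 else 0 := by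
    split_ifs with hq
    · rw [Finset.card_eq_two]
      refine ⟨h, Γ.i h, (Γ.i_ne h).symm, ?_⟩
      ext k
      simp only [Finset.mem_filter, Finset.mem_univ, true_and, Finset.mem_insert,
        Finset.mem_singleton]
      constructor
      · rintro ⟨_, hk⟩
        tauto
      · rintro (rfl | rfl)
        · exact ⟨hq, by tauto⟩
        · exact ⟨e2.trans hq, by tauto⟩
    · rw [Finset.card_eq_zero, Finset.filter_eq_empty_iff]
      rintro k _ ⟨hk, hk'⟩
      have : k = h ∨ k = Γ.i h := by tauto
      rcases this with rfl | rfl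
      · exact hq hk
      · exact hq (e2.symm.trans hk)
  have e5 : (Finset.univ.filter fun k => (k ≠ h ∧ k ≠ Γ.i h) ∧ Γ.contractVert h (Γ.a k) = q) =
      Finset.univ.filter fun k => Γ.contractVert h (Γ.a k) = q ∧ (k ≠ h ∧ k ≠ Γ.i h) := by
    ext k
    simp only [Finset.mem_filter, Finset.mem_univ, true_and]
    tauto
  have e6 := congrArg (Nat.cast : ℕ → ℤ) e0
  push_cast at e6
  rw [e6, ← e3, e4, e1, e5]
  push_cast
  rfl

open Classical in
theorem omegaDeg_contract (Γ : MarkedGraph n) (h : Γ.HalfEdge)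
    (q : Quotient (Γ.contractSetoid h)) :
    (Γ.strictContraction h).omegaDeg q = ∑ v with Γ.contractVert h v = q, Γ.omegaDeg v := by
  have e1 := congrArg (Int.cast : ℤ → ℝ) (Γ.valence_contract h q)
  have e2 := congrArg (Nat.cast : ℕ → ℝ) (Γ.card_fiber h q)
  have e3 : ((Γ.strictContraction h).genus q : ℝ) =
      (∑ v with Γ.contractVert h v = q, (Γ.genus v : ℝ)) +
        if Γ.a h = Γ.a (Γ.i h) ∧ Γ.contractVert h (Γ.a h) = q then 1 else 0 := by
    simp only [strictContraction]
    push_cast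
    congr
  push_cast at e1 e2
  simp only [omegaDeg, Finset.sum_add_distrib, Finset.sum_sub_distrib, ← Finset.mul_sum,
    Finset.sum_const, nsmul_eq_mul, ← e1, e2, e3]
  generalize hA : Γ.contractVert h (Γ.a h) = q₀
  by_cases hl : Γ.a h = Γ.a (Γ.i h) <;> by_cases hq : q₀ = q <;>
    simp only [hl, hq, ne_eq, not_true_eq_false, not_false_eq_true, and_true, and_false,
      if_true, if_false] <;> ring

open Classical in
theorem Contraction.sum_eq {Γ Γ' : MarkedGraph n} (c : Contraction Γ Γ') (φ : Γ.Vert → ℝ)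
    (v' : Γ'.Vert) : ∑ v with c.onVert v = v', φ v =
      ∑ v with Γ.contractVert c.half v = c.iso.vert.symm v', φ v := by
  have e : ∀ v, c.onVert v = v' ↔ Γ.contractVert c.half v = c.iso.vert.symm v' := fun v =>
    (Equiv.eq_symm_apply c.iso.vert).symm
  simp only [e]

end MarkedGraph

theorem GraphClass.arithGenus_eq {g n : ℕ} (Γ : GraphClass g n) : Γ.graph.arithGenus = g :=
  (Quotient.out Γ).2.2

theorem canonicalParameter_sum (g n : ℕ) [hgn : Fact (2 < 2 * g + n)] (d : ℝ)
    (Γ : GraphClass g n) : ∑ v, canonicalParameter g n d Γ v = d := by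
  by_cases hg : 2 ≤ g
  · simp only [canonicalParameter, hg, dite_true, ← Finset.mul_sum, sum_omegaDeg,
      Γ.arithGenus_eq]
    have : (2 * (g : ℝ) - 2) ≠ 0 := by
      have : (2 : ℝ) ≤ g := by exact_mod_cast hg
      linarith
    rw [Int.cast_natCast, div_mul_cancel₀ _ this]
  · simp only [canonicalParameter, hg, dite_false, ← Finset.mul_sum, sum_sectionDeg, mul_one]

theorem canonicalParameter_mem (g n : ℕ) [hgn : Fact (2 < 2 * g + n)] (d : ℝ) :
    canonicalParameter g n d ∈ stabilitySpaceDeg g n d := by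
  classical
  refine ⟨⟨fun Γ α v => ?_, fun Γ₁ Γ₂ c v => ?_⟩, canonicalParameter_sum g n d⟩
  · simp only [canonicalParameter, α.omegaDeg_eq, α.sectionDeg_eq]
  · have e1 := c.iso.omegaDeg_eq (c.iso.vert.symm v)
    have e2 := fun j => c.iso.sectionDeg_eq j (c.iso.vert.symm v)
    simp only [Equiv.apply_symm_apply] at e1 e2
    by_cases hg : 2 ≤ g
    · simp only [canonicalParameter, hg, dite_true, ← Finset.mul_sum]
      rw [e1]
      congr 1
      refine (omegaDeg_contract _ _ _).trans ?_
      convert (c.sum_eq _ v).symm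
    · simp only [canonicalParameter, hg, dite_false, ← Finset.mul_sum]
      rw [e2]
      congr 1
      refine (sectionDeg_contract _ _ _ _).trans ?_
      convert (c.sum_eq _ v).symm

/-- The canonical parameter as a point of `V^d_{g,n}`. -/
noncomputable def canonicalPoint (g n : ℕ) [Fact (2 < 2 * g + n)] (d : ℝ) :
    stabilitySpaceDeg g n d := ⟨canonicalParameter g n d, canonicalParameter_mem g n d⟩

instance stabilitySpaceDeg_nonempty (g n : ℕ) [Fact (2 < 2 * g + n)] (d : ℝ) :
    Nonempty (stabilitySpaceDeg g n d) := ⟨canonicalPoint g n d⟩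

/-! The vine graphs `Γ(i,S)` and `Γ_j`. -/

/-- The indices `(i, S)`: `0 ≤ i ≤ g` and `S` is a set of markings, with at least two elements if
`i = 0` and with at least two elements in its complement if `i = g`; moreover `S` contains the
first marking if there is one, and `i < g - i` if there are no markings. -/
structure SepIndex (g n : ℕ) where
  i : ℕ
  S : Finset (Fin n)
  i_le : i ≤ g
  two_le_card : i = 0 → 2 ≤ S.card
  card_add_two_le : i = g → S.card + 2 ≤ n
  lt_of_unmarked : n = 0 → i < g - i
  first_mem : ∀ j : Fin n, j.val = 0 → j ∈ S

/-- The graph `Γ(i,S)`: the vertex `true` has genus `i` and markings `S`, the vertex `false` has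
genus `g - i` and the other markings, and one edge joins them. -/
def sepGraph {g n : ℕ} (p : SepIndex g n) : MarkedGraph n where
  Vert := Bool
  HalfEdge := Bool
  fintypeVert := inferInstance
  fintypeHalfEdge := inferInstance
  a b := b
  i b := !b
  i_i b := by simp
  i_ne b := by simp
  genus b := if b then p.i else g - p.i
  mark j := decide (j ∈ p.S)

/-- The indices `j` of the graphs `Γ_j`: there are none if `g = 0`, the markings other than the
first one if `g = 1`, and all the markings if `g ≥ 2`. -/
structure NonsepIndex (g n : ℕ) where
  j : Fin n
  one_le : 1 ≤ g
  ne_first : g = 1 → j.val ≠ 0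

/-- The graph `Γ_j`: the vertex `true` has genus `0` and the marking `j`, the vertex `false` has
genus `g - 1` and the other markings, and two edges join them. -/
def nonsepGraph {g n : ℕ} (p : NonsepIndex g n) : MarkedGraph n where
  Vert := Bool
  HalfEdge := Bool × Bool
  fintypeVert := inferInstance
  fintypeHalfEdge := inferInstance
  a h := h.1
  i h := (!h.1, h.2)
  i_i h := by simp
  i_ne h e := by simpa using congrArg Prod.fst e
  genus b := if b then 0 else g - 1
  mark k := decide (k = p.j)

theorem MarkedGraph.edge_card {n : ℕ} (Γ : MarkedGraph n) {m : ℕ}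
    (h : Nat.card Γ.HalfEdge = 2 * m) : Nat.card Γ.Edge = m := by
  have := Γ.card_halfEdge
  omega

theorem sepGraph_connected {g n : ℕ} (p : SepIndex g n) : (sepGraph p).IsConnected := by
  have h : ∀ b : Bool, (sepGraph p).Adj b (!b) := fun b => ⟨b, rfl, rfl⟩
  refine ⟨⟨true⟩, fun (v : Bool) (w : Bool) => ?_⟩
  by_cases e : v = w
  · rw [e]
    exact Relation.ReflTransGen.refl
  · obtain rfl : w = !v := by cases v <;> cases w <;> simp_all
    exact Relation.ReflTransGen.single (h v)

theorem sepGraph_stable {g n : ℕ} (p : SepIndex g n) :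
    (sepGraph p).IsStable ∧ (sepGraph p).arithGenus = g := by
  have hi := p.i_le
  refine ⟨⟨sepGraph_connected p, fun (v : Bool) hv => ?_⟩, ?_⟩
  · have e1 : (sepGraph p).valence v = 1 := by
      change Nat.card {h : Bool // h = v} = 1
      simp
    have e2 : 2 ≤ (sepGraph p).numMarks v := by
      change 2 ≤ Nat.card {j // decide (j ∈ p.S) = v}
      cases v with
      | true =>
        have : p.i = 0 := hv
        simpa using p.two_le_card this
      | false =>
        have h0 : g - p.i = 0 := hv
        have h1 := p.card_add_two_le (by omega)
        have h2 := Finset.card_compl p.S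
        rw [Fintype.card_fin] at h2
        simp only [decide_eq_false_iff_not]
        rw [Nat.card_eq_fintype_card, Fintype.card_subtype]
        have h3 : (Finset.univ.filter fun j => j ∉ p.S) = p.Sᶜ := by
          ext j
          simp
        rw [h3]
        omega
    omega
  · have e1 : Nat.card (sepGraph p).Edge = 1 :=
      edge_card _ (show Nat.card Bool = 2 * 1 by simp)
    have e2 : Nat.card (sepGraph p).Vert = 2 := show Nat.card Bool = 2 by simp
    have e3 : (∑ v, ((sepGraph p).genus v : ℤ)) = g := by
      change (∑ b : Bool, ((if b then p.i else g - p.i : ℕ) : ℤ)) = g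
      simp only [Fintype.sum_bool, if_true, Bool.false_eq_true, if_false]
      omega
    rw [arithGenus, e1, e2, e3]
    push_cast
    ring

theorem nonsepGraph_connected {g n : ℕ} (p : NonsepIndex g n) :
    (nonsepGraph p).IsConnected := by
  have h : ∀ b : Bool, (nonsepGraph p).Adj b (!b) := fun b => ⟨(b, true), rfl, rfl⟩
  refine ⟨⟨true⟩, fun (v : Bool) (w : Bool) => ?_⟩
  by_cases e : v = w
  · rw [e]
    exact Relation.ReflTransGen.refl
  · obtain rfl : w = !v := by cases v <;> cases w <;> simp_all
    exact Relation.ReflTransGen.single (h v)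

theorem nonsepGraph_stable {g n : ℕ} (p : NonsepIndex g n) :
    (nonsepGraph p).IsStable ∧ (nonsepGraph p).arithGenus = g := by
  have hg := p.one_le
  refine ⟨⟨nonsepGraph_connected p, fun (v : Bool) hv => ?_⟩, ?_⟩
  · have e1 : (nonsepGraph p).valence v = 2 := by
      change Nat.card {h : Bool × Bool // h.1 = v} = 2
      rw [Nat.card_eq_fintype_card]
      cases v <;> rfl
    have e2 : 1 ≤ (nonsepGraph p).numMarks v := by
      change 1 ≤ Nat.card {k // decide (k = p.j) = v}
      have : Nonempty {k // decide (k = p.j) = v} := by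
        cases v with
        | true => exact ⟨p.j, by simp⟩
        | false =>
          have h0 : g - 1 = 0 := hv
          have h1 := p.ne_first (by omega)
          refine ⟨⟨0, by have := p.j.isLt; omega⟩, ?_⟩
          rw [decide_eq_false_iff_not]
          exact fun e => h1 (congrArg Fin.val e).symm
      exact Nat.card_pos
    omega
  · have e1 : Nat.card (nonsepGraph p).Edge = 2 :=
      edge_card _ (show Nat.card (Bool × Bool) = 2 * 2 by simp)
    have e2 : Nat.card (nonsepGraph p).Vert = 2 := show Nat.card Bool = 2 by simp
    have e3 : (∑ v, ((nonsepGraph p).genus v : ℤ)) = g - 1 := by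
      change (∑ b : Bool, ((if b then 0 else g - 1 : ℕ) : ℤ)) = g - 1
      simp only [Fintype.sum_bool, if_true, Bool.false_eq_true, if_false]
      omega
    rw [arithGenus, e1, e2, e3]
    push_cast
    ring

/-- The element `Γ(i,S)` of `G_{g,n}`. -/
def sepClass {g n : ℕ} (p : SepIndex g n) : GraphClass g n :=
  StableGraph.cls ⟨sepGraph p, sepGraph_stable p⟩

/-- The element `Γ_j` of `G_{g,n}`. -/
def nonsepClass {g n : ℕ} (p : NonsepIndex g n) : GraphClass g n :=
  StableGraph.cls ⟨nonsepGraph p, nonsepGraph_stable p⟩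

theorem isVine_graph_cls {g n : ℕ} (Γ : StableGraph g n) (h : Γ.1.IsVine) :
    Γ.cls.graph.IsVine := by
  obtain ⟨f⟩ : Nonempty (Iso Γ.cls.graph Γ.1) := Quotient.mk_out (s := isoSetoid g n) Γ
  refine ⟨(Nat.card_congr f.vert).trans h.1, fun k e => h.2 (f.half k) ?_⟩
  rw [← f.i_comm, ← f.a_comm, ← f.a_comm, e]

theorem sepClass_isVine {g n : ℕ} (p : SepIndex g n) : (sepClass p).graph.IsVine :=
  isVine_graph_cls _ ⟨by simp [sepGraph], fun h => by cases h <;> simp [sepGraph]⟩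

theorem nonsepClass_isVine {g n : ℕ} (p : NonsepIndex g n) : (nonsepClass p).graph.IsVine :=
  isVine_graph_cls _ ⟨by simp [nonsepGraph], fun h => by
    rcases h with ⟨b, c⟩
    cases b <;> simp [nonsepGraph]⟩

/-- The elements of `G_{g,n}` with two vertices and no loops. -/
abbrev VineClass (g n : ℕ) : Type 1 := {Γ : GraphClass g n // Γ.graph.IsVine}

/-- The space `T_{g,n}`, the sum of the spaces `V⁰(Γ)` over the (finitely many) vine graphs. -/
abbrev TSpace (g n : ℕ) : Type 1 := (Γ : VineClass g n) → Γ.1.graph.degreeZero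

/-- The space `C_{g,n}`, the sum of the spaces `V⁰(Γ(i,S))`. -/
abbrev CSpace (g n : ℕ) : Type := (p : SepIndex g n) → (sepClass p).graph.degreeZero

/-- The space `D_{g,n}`, the sum of the spaces `V⁰(Γ_j)`. -/
abbrev DSpace (g n : ℕ) : Type := (p : NonsepIndex g n) → (nonsepClass p).graph.degreeZero

/-- The projection `T_{g,n} → C_{g,n}`. -/
noncomputable def projC (g n : ℕ) : TSpace g n →ₗ[ℝ] CSpace g n where
  toFun t p := t ⟨sepClass p, sepClass_isVine p⟩
  map_add' _ _ := rfl
  map_smul' _ _ := rfl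

/-- The projection `T_{g,n} → D_{g,n}`. -/
noncomputable def projD (g n : ℕ) : TSpace g n →ₗ[ℝ] DSpace g n where
  toFun t p := t ⟨nonsepClass p, nonsepClass_isVine p⟩
  map_add' _ _ := rfl
  map_smul' _ _ := rfl

/-- The map `ρ^d : V^d_{g,n} → T_{g,n}`: translate by the canonical parameter, then restrict to the
vine graphs. -/
noncomputable def restrictVine (g n : ℕ) [Fact (2 < 2 * g + n)] (d : ℝ)
    (φ : stabilitySpaceDeg g n d) : TSpace g n := fun Γ =>
  ⟨φ.1 Γ.1 - canonicalParameter g n d Γ.1, by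
    change ∑ v, (φ.1 Γ.1 v - canonicalParameter g n d Γ.1 v) = 0
    rw [Finset.sum_sub_distrib, canonicalParameter_sum, φ.2.2 Γ.1, sub_self]⟩

/-- The number `N(g,n)` of boundary divisors of the moduli space of stable `n`-pointed curves of
genus `g`: they are the closures of the loci of curves with exactly one node, one for every stable
graph with exactly one edge. -/
noncomputable def numBoundaryDivisors (g n : ℕ) : ℕ :=
  Nat.card {Γ : GraphClass g n // Nat.card Γ.graph.Edge = 1}

end UniversalStability

open UniversalStability MarkedGraph

namespace UniversalStability

/-! ### Strict contractions preserve stability and genus -/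

namespace MarkedGraph

variable {n : ℕ}

/-! Translation by the canonical parameter reduces the isomorphism to parameters of degree zero,
where injectivity and surjectivity have different reasons.

Injectivity. Colour the vertices of a stable graph with two colours so that both colour classes are
nonempty and connected. Contracting the monochromatic edges leaves a loopless graph with two
vertices, and this graph is determined by the ω-degree `w` of one side, the markings `S` on that
side and the number `t` of edges. The value of φ on the side is therefore a function `cutValue φ w S
t` (`cutSum_eq`). Total degree zero makes this function odd under passing to the other side
(`cutValue_compl`), and a triangle with edge multiplicities 1, 1, `k` gives an additivity law
(`cutValue_union`).

Suppose now that the components at the special graphs vanish. For `t = 1`, the pairs (i,S) meet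
every complementary pair of sides, so oddness suffices. For `t = 2`, additivity reduces everything
to a side of genus 0 with one marking, where the Γ_j apply, and to a side of genus 1 without
markings, whose value is killed by comparing additivity with oddness. For `t ≥ 3`, additivity makes
the value independent of genus and markings, and an odd constant is zero. So φ vanishes on all
graphs with two vertices and no loops, and an induction on the number of half-edges carries this to
every stable graph (`extend_eq_zero`).

Surjectivity. Parameters arise from line bundles on the universal curve. The sections, corrected to
degree zero by the canonical parameter, give the standard basis at the Γ_j. The boundary components,
through `twist`, give the standard basis at the Γ(i,S) and vanish at the Γ_j. The resulting system
is triangular (`exists_components`).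

For the count, a stable graph with one edge is either the loop or, its first marking singling out a
vertex, exactly one Γ(i,S). -/

theorem contractVert_surjective (Γ : MarkedGraph n) (h : Γ.HalfEdge) :
    Function.Surjective (Γ.contractVert h) := Quotient.mk_surjective

theorem contractVert_a_i (Γ : MarkedGraph n) (h : Γ.HalfEdge) :
    Γ.contractVert h (Γ.a (Γ.i h)) = Γ.contractVert h (Γ.a h) :=
  (Γ.contractVert_eq h _ _).2 (Or.inr ⟨Or.inr rfl, Or.inl rfl⟩)

theorem Adj.symm {Γ : MarkedGraph n} {v w : Γ.Vert} (h : Γ.Adj v w) : Γ.Adj w v := by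
  obtain ⟨k, rfl, rfl⟩ := h
  exact ⟨Γ.i k, rfl, by rw [Γ.i_i]⟩

theorem contractVert_adj (Γ : MarkedGraph n) (h : Γ.HalfEdge) {v w : Γ.Vert} (e : Γ.Adj v w) :
    Γ.contractVert h v = Γ.contractVert h w ∨
      (Γ.strictContraction h).Adj (Γ.contractVert h v) (Γ.contractVert h w) := by
  obtain ⟨k, rfl, rfl⟩ := e
  by_cases h1 : k = h
  · subst h1
    exact Or.inl (Γ.contractVert_a_i k).symm
  by_cases h2 : k = Γ.i h
  · subst h2
    rw [Γ.i_i]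
    exact Or.inl (Γ.contractVert_a_i h)
  exact Or.inr ⟨⟨k, h1, h2⟩, rfl, rfl⟩

theorem strictContraction_isConnected {Γ : MarkedGraph n} (hΓ : Γ.IsConnected)
    (h : Γ.HalfEdge) : (Γ.strictContraction h).IsConnected := by
  refine ⟨⟨Γ.contractVert h (Γ.a h)⟩, fun v w => ?_⟩
  obtain ⟨v, rfl⟩ := Γ.contractVert_surjective h v
  obtain ⟨w, rfl⟩ := Γ.contractVert_surjective h w
  refine Relation.ReflTransGen.lift' (Γ.contractVert h) ?_ _ _ (hΓ.2 v w)
  intro v w e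
  rcases Γ.contractVert_adj h e with e | e
  · change Relation.ReflTransGen _ (Γ.contractVert h v) (Γ.contractVert h w)
    rw [e]
    exact Relation.ReflTransGen.refl
  · exact Relation.ReflTransGen.single e

-- One regrouping over the fibres of the contraction serves every function that is pushed forward by
-- summation: the ω-degree as well as the parameters themselves.
open Classical in
theorem sum_contract (Γ : MarkedGraph n) (h : Γ.HalfEdge) (f : Γ.Vert → ℝ)
    (F : (Γ.strictContraction h).Vert → ℝ)
    (hF : ∀ q : Quotient (Γ.contractSetoid h), F q = ∑ v with Γ.contractVert h v = q, f v)
    (P : (Γ.strictContraction h).Vert → Prop) :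
    ∑ q with P q, F q = ∑ v with P (Γ.contractVert h v), f v := by
  rw [← Finset.sum_fiberwise_of_maps_to
    (s := Finset.univ.filter fun v => P (Γ.contractVert h v))
    (t := Finset.univ.filter P) (g := Γ.contractVert h)
    (fun v hv => Finset.mem_filter.2 ⟨Finset.mem_univ _, (Finset.mem_filter.1 hv).2⟩)]
  refine Finset.sum_congr rfl fun q hq => ?_
  refine (hF q).trans (Finset.sum_congr ?_ fun _ _ => rfl)
  ext v
  simp only [Finset.mem_filter, Finset.mem_univ, true_and] at hq ⊢
  constructor
  · rintro rfl
    exact ⟨hq, rfl⟩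
  · exact fun e => e.2

open Classical in
theorem sum_contract_univ (Γ : MarkedGraph n) (h : Γ.HalfEdge) (f : Γ.Vert → ℝ)
    (F : (Γ.strictContraction h).Vert → ℝ)
    (hF : ∀ q : Quotient (Γ.contractSetoid h), F q = ∑ v with Γ.contractVert h v = q, f v) :
    ∑ q, F q = ∑ v, f v := by
  simpa using Γ.sum_contract h f F hF fun _ => True

/-- The total ω-degree is `2 * arithGenus - 2`, and the ω-degree is summed over the fibres of a
contraction; so no count of edges and vertices is needed. -/
theorem arithGenus_strictContraction (Γ : MarkedGraph n) (h : Γ.HalfEdge) :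
    (Γ.strictContraction h).arithGenus = Γ.arithGenus := by
  classical
  have e := (Γ.strictContraction h).sum_omegaDeg
  have e' : ∑ q, (Γ.strictContraction h).omegaDeg q = ∑ v, Γ.omegaDeg v :=
    Γ.sum_contract_univ h _ _ (Γ.omegaDeg_contract h)
  rw [e', Γ.sum_omegaDeg] at e
  have : (Γ.arithGenus : ℝ) = (Γ.strictContraction h).arithGenus := by linarith
  exact_mod_cast this.symm

-- The number of markings is a sum of section degrees, which are already known to push forward.
open Classical in
theorem numMarks_contract (Γ : MarkedGraph n) (h : Γ.HalfEdge)
    (q : Quotient (Γ.contractSetoid h)) :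
    (Γ.strictContraction h).numMarks q = ∑ v with Γ.contractVert h v = q, Γ.numMarks v := by
  have e : ∀ Γ : MarkedGraph n, ∀ v, (Γ.numMarks v : ℝ) = ∑ j, Γ.sectionDeg j v := by
    intro Γ v
    simp [numMarks, sectionDeg, Fintype.card_subtype]
  have : ((Γ.strictContraction h).numMarks q : ℝ) =
      ∑ v with Γ.contractVert h v = q, (Γ.numMarks v : ℝ) := by
    refine (e (Γ.strictContraction h) q).trans ?_
    simp only [e]
    rw [Finset.sum_comm]
    exact Finset.sum_congr rfl (fun j _ => Γ.sectionDeg_contract h j q :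
      ∀ j ∈ Finset.univ, (Γ.strictContraction h).sectionDeg j q = _)
  exact_mod_cast this

/-- Over a vertex of genus 0 all vertices have genus 0, and the contracted edge is not a loop there.
If the edge lands on this vertex, the fibre contributes at least `2 * 3` half-edges and markings, of
which two are lost; otherwise the fibre is a single vertex and nothing is lost. -/
theorem strictContraction_isStable {Γ : MarkedGraph n} (hΓ : Γ.IsStable) (h : Γ.HalfEdge) :
    (Γ.strictContraction h).IsStable := by
  classical
  refine ⟨strictContraction_isConnected hΓ.1 h, fun (q : Quotient (Γ.contractSetoid h)) hq => ?_⟩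
  have hg : (∑ v with Γ.contractVert h v = q, Γ.genus v) +
    (if Γ.a h = Γ.a (Γ.i h) ∧ Γ.contractVert h (Γ.a h) = q then 1 else 0) = 0 := hq
  have h0 : ∀ v ∈ Finset.univ.filter (fun v => Γ.contractVert h v = q), Γ.genus v = 0 := by
    have := (Nat.add_eq_zero_iff.1 hg).1
    exact fun v hv => Finset.sum_eq_zero_iff.1 this v hv
  have h1 : ¬ (Γ.a h = Γ.a (Γ.i h) ∧ Γ.contractVert h (Γ.a h) = q) := by
    intro e
    have := (Nat.add_eq_zero_iff.1 hg).2
    rw [if_pos e] at this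
    exact one_ne_zero this
  have e1 := Γ.valence_contract h q
  have e2 := Γ.numMarks_contract h q
  have e3 := Γ.card_fiber h q
  have e4 := Finset.card_nsmul_le_sum (Finset.univ.filter (fun v => Γ.contractVert h v = q))
    (fun v => Γ.valence v + Γ.numMarks v) 3 (fun v hv => hΓ.2 v (h0 v hv))
  rw [Finset.sum_add_distrib, ← e2] at e4
  have e5 : ((∑ v with Γ.contractVert h v = q, Γ.valence v : ℕ) : ℤ) =
    ∑ v with Γ.contractVert h v = q, (Γ.valence v : ℤ) := by push_cast; rfl
  rw [← e5] at e1
  rw [smul_eq_mul] at e4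
  by_cases hq0 : Γ.contractVert h (Γ.a h) = q
  · have : Γ.a h ≠ Γ.a (Γ.i h) := fun e => h1 ⟨e, hq0⟩
    simp only [hq0, this, ne_eq, not_false_eq_true, and_self, if_true] at e1 e3
    omega
  · simp only [hq0, and_false, if_false] at e1 e3
    omega

open Classical in
/-- An isomorphism induces an isomorphism of strict contractions. -/
noncomputable def Iso.contract {Γ Γ' : MarkedGraph n} (f : Iso Γ Γ') (h : Γ.HalfEdge) :
    Iso (Γ.strictContraction h) (Γ'.strictContraction (f.half h)) :=
  have hend : ∀ v, Γ'.IsEnd (f.half h) (f.vert v) ↔ Γ.IsEnd h v := fun v => by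
    simp only [IsEnd, ← f.i_comm, ← f.a_comm, f.vert.apply_eq_iff_eq]
  have hcl : ∀ v w, Γ'.contractVert (f.half h) (f.vert v) = Γ'.contractVert (f.half h) (f.vert w) ↔
      Γ.contractVert h v = Γ.contractVert h w := fun v w => by
    simp only [contractVert_eq, hend, f.vert.apply_eq_iff_eq]
  { vert := Quotient.congr f.vert fun v w => by
      have := (hcl v w).symm
      simp only [contractVert, Quotient.eq] at this
      exact this
    half := f.half.subtypeEquiv fun k => by
      simp only [ne_eq, ← f.i_comm, f.half.apply_eq_iff_eq]
    a_comm := fun k => congrArg (Γ'.contractVert (f.half h)) (f.a_comm k.1)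
    i_comm := fun k => Subtype.ext (f.i_comm k.1)
    mark_comm := fun j => congrArg (Γ'.contractVert (f.half h)) (f.mark_comm j)
    genus_comm := fun q => by
      obtain ⟨w, rfl⟩ := Γ.contractVert_surjective h q
      change (∑ v with Γ'.contractVert (f.half h) v = Γ'.contractVert (f.half h) (f.vert w),
        Γ'.genus v) + (if Γ'.a (f.half h) = Γ'.a (Γ'.i (f.half h)) ∧
          Γ'.contractVert (f.half h) (Γ'.a (f.half h)) = Γ'.contractVert (f.half h) (f.vert w)
          then 1 else 0) = (∑ v with Γ.contractVert h v = Γ.contractVert h w, Γ.genus v) +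
          if Γ.a h = Γ.a (Γ.i h) ∧ Γ.contractVert h (Γ.a h) = Γ.contractVert h w then 1 else 0
      simp only [← f.i_comm, ← f.a_comm, hcl, f.vert.apply_eq_iff_eq]
      congr 1
      rw [Finset.sum_filter, Finset.sum_filter, ← f.vert.sum_comp]
      simp only [hcl, f.genus_comm] }

theorem card_halfEdge_strictContraction_lt (Γ : MarkedGraph n) (h : Γ.HalfEdge) :
    Nat.card (Γ.strictContraction h).HalfEdge < Nat.card Γ.HalfEdge := by
  classical
  change Nat.card {k : Γ.HalfEdge // k ≠ h ∧ k ≠ Γ.i h} < _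
  rw [Nat.card_eq_fintype_card, Nat.card_eq_fintype_card]
  exact Fintype.card_subtype_lt (x := h) (by simp)

end MarkedGraph

/-! ### Extending parameters from representatives to all stable graphs -/

variable {g n : ℕ}

/-- The contraction of an edge of a stable graph, as a stable graph. -/
noncomputable def StableGraph.contract (Γ : StableGraph g n) (h : Γ.1.HalfEdge) :
    StableGraph g n :=
  ⟨Γ.1.strictContraction h, strictContraction_isStable Γ.2.1 h,
    (Γ.1.arithGenus_strictContraction h).trans Γ.2.2⟩

/-- An isomorphism to the representative of the isomorphism class. -/
noncomputable def StableGraph.isoRep (Γ : StableGraph g n) : Iso Γ.1 Γ.cls.graph :=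
  Classical.choice (Setoid.symm (Quotient.mk_out (s := isoSetoid g n) Γ))

/-- The extension of a parameter to all stable graphs. -/
noncomputable def extend (φ : Ambient g n) (Γ : StableGraph g n) (v : Γ.1.Vert) : ℝ :=
  φ Γ.cls (Γ.isoRep.vert v)

/-- Two isomorphisms to a representative differ by an automorphism of it, under which φ is
invariant; hence the arbitrary choice in `isoRep` does not matter. -/
theorem apply_iso_eq_extend {φ : Ambient g n} (hφ : φ ∈ stabilitySpace g n) (Γ : StableGraph g n)
    (C : GraphClass g n) (f : Iso Γ.1 C.graph) (v : Γ.1.Vert) :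
    φ C (f.vert v) = extend φ Γ v := by
  obtain rfl : Γ.cls = C := by
    have : Γ.cls = StableGraph.cls (Quotient.out C) := Quotient.sound ⟨f⟩
    rw [this]
    exact Quotient.out_eq C
  have := hφ.1 Γ.cls (f.symm.trans Γ.isoRep) (f.vert v)
  rw [← this]
  simp [Iso.trans, Iso.symm, extend]

theorem extend_iso {φ : Ambient g n} (hφ : φ ∈ stabilitySpace g n) {Γ Γ' : StableGraph g n}
    (f : Iso Γ.1 Γ'.1) (v : Γ.1.Vert) : extend φ Γ' (f.vert v) = extend φ Γ v :=
  apply_iso_eq_extend hφ Γ Γ'.cls (f.trans Γ'.isoRep) v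

theorem extend_out {φ : Ambient g n} (hφ : φ ∈ stabilitySpace g n) (C : GraphClass g n)
    (v : C.graph.Vert) : extend φ (Quotient.out C) v = φ C v :=
  (apply_iso_eq_extend hφ (Quotient.out C) C (Iso.refl _) v).symm

-- Conjugating the strict contraction by the isomorphisms to the representatives turns it into a
-- contraction between elements of `GraphClass`, to which compatibility applies.
open Classical in
theorem extend_contract {φ : Ambient g n} (hφ : φ ∈ stabilitySpace g n) (Γ : StableGraph g n)
    (h : Γ.1.HalfEdge) (q : Quotient (Γ.1.contractSetoid h)) :
    extend φ (Γ.contract h) q = ∑ v with Γ.1.contractVert h v = q, extend φ Γ v := by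
  let f := Γ.isoRep
  let c : Contraction Γ.cls.graph (Γ.contract h).cls.graph :=
    ⟨f.half h, (f.contract h).symm.trans (Γ.contract h).isoRep⟩
  refine (hφ.2 _ _ c ((Γ.contract h).isoRep.vert q)).trans ?_
  rw [Finset.sum_filter, Finset.sum_filter, ← f.vert.sum_comp]
  refine Finset.sum_congr rfl fun v _ => ?_
  have e : c.onVert (f.vert v) = (Γ.contract h).isoRep.vert (Γ.1.contractVert h v) := by
    change (Γ.contract h).isoRep.vert ((f.contract h).vert.symm
      (Γ.cls.graph.contractVert (f.half h) (f.vert v))) = _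
    exact congrArg _ ((f.contract h).vert.symm_apply_apply (Γ.1.contractVert h v))
  rw [e]
  exact if_congr (Equiv.apply_eq_iff_eq _) rfl rfl

theorem sum_extend {d : ℝ} {φ : Ambient g n} (hφ : φ ∈ stabilitySpaceDeg g n d)
    (Γ : StableGraph g n) : ∑ v, extend φ Γ v = d := by
  rw [← hφ.2 Γ.cls]
  exact Γ.isoRep.vert.sum_comp (φ Γ.cls)

/-! ### Two-colourings of graphs and their invariants -/

namespace MarkedGraph

variable {n : ℕ}

/-- A colouring of the vertices by two colours, both used, whose colour classes are connected. -/
structure IsCut (Γ : MarkedGraph n) (s : Γ.Vert → Bool) : Prop where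
  surj : Function.Surjective s
  conn : ∀ v w, s v = s w → Relation.ReflTransGen (fun v w => Γ.Adj v w ∧ s v = s w) v w

/-- The degree of the dualizing sheaf on the subcurve of the vertices coloured `true`. -/
noncomputable def sideDeg (Γ : MarkedGraph n) (s : Γ.Vert → Bool) : ℝ :=
  ∑ v with s v = true, Γ.omegaDeg v

/-- The markings on the vertices coloured `true`. -/
def sideMarks (Γ : MarkedGraph n) (s : Γ.Vert → Bool) : Finset (Fin n) :=
  Finset.univ.filter fun j => s (Γ.mark j) = true

/-- The number of edges that join vertices of different colours. -/
noncomputable def cutNumber (Γ : MarkedGraph n) (s : Γ.Vert → Bool) : ℕ :=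
  Nat.card {h // s (Γ.a h) = true ∧ s (Γ.a (Γ.i h)) = false}

theorem sum_filter_not (Γ : MarkedGraph n) (s : Γ.Vert → Bool) (f : Γ.Vert → ℝ) :
    ∑ v with (!s v) = true, f v = ∑ v, f v - ∑ v with s v = true, f v := by
  rw [← Finset.sum_filter_add_sum_filter_not Finset.univ (fun v => s v = true) f]
  simp

theorem sideDeg_not (Γ : MarkedGraph n) (s : Γ.Vert → Bool) :
    Γ.sideDeg (fun v => !s v) = 2 * (Γ.arithGenus : ℝ) - 2 - Γ.sideDeg s := by
  rw [sideDeg, sum_filter_not, sum_omegaDeg, sideDeg]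

theorem sideMarks_not (Γ : MarkedGraph n) (s : Γ.Vert → Bool) :
    Γ.sideMarks (fun v => !s v) = (Γ.sideMarks s)ᶜ := by
  ext j
  simp [sideMarks]

theorem cutNumber_not (Γ : MarkedGraph n) (s : Γ.Vert → Bool) :
    Γ.cutNumber (fun v => !s v) = Γ.cutNumber s := by
  refine Nat.card_congr (Equiv.subtypeEquiv ⟨Γ.i, Γ.i, Γ.i_i, Γ.i_i⟩ fun h => ?_)
  simp [Γ.i_i, and_comm]

theorem IsCut.not {Γ : MarkedGraph n} {s : Γ.Vert → Bool} (hs : Γ.IsCut s) :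
    Γ.IsCut fun v => !s v := by
  refine ⟨fun b => ?_, fun v w e => ?_⟩
  · obtain ⟨v, hv⟩ := hs.surj (!b)
    exact ⟨v, by simp [hv]⟩
  · simpa using hs.conn v w (by simpa using e)

open Classical in
theorem sum_contract_color (Γ : MarkedGraph n) (h : Γ.HalfEdge) (f : Γ.Vert → ℝ)
    (F : (Γ.strictContraction h).Vert → ℝ)
    (hF : ∀ q : Quotient (Γ.contractSetoid h), F q = ∑ v with Γ.contractVert h v = q, f v)
    (s : (Γ.strictContraction h).Vert → Bool) :
    ∑ q with s q = true, F q = ∑ v with s (Γ.contractVert h v) = true, f v := by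
  convert Γ.sum_contract h f F hF fun q => s q = true

theorem sideDeg_contract (Γ : MarkedGraph n) (h : Γ.HalfEdge)
    (s : (Γ.strictContraction h).Vert → Bool) :
    (Γ.strictContraction h).sideDeg s = Γ.sideDeg fun v => s (Γ.contractVert h v) :=
   Γ.sum_contract_color h _ _ (Γ.omegaDeg_contract h) s

theorem ne_of_cut {Γ : MarkedGraph n} {h : Γ.HalfEdge} {s : Γ.Vert → Bool}
    (hs : s (Γ.a h) = s (Γ.a (Γ.i h))) {k : Γ.HalfEdge}
    (hk : s (Γ.a k) = true ∧ s (Γ.a (Γ.i k)) = false) : k ≠ h ∧ k ≠ Γ.i h := by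
  constructor
  · rintro rfl
    simp [hs, hk.2] at hk
  · rintro rfl
    rw [Γ.i_i, hs] at hk
    simp [hk.1] at hk

/-- The contracted edge is monochromatic for the pulled back colouring, so no crossing edge is lost.
-/
theorem cutNumber_contract (Γ : MarkedGraph n) (h : Γ.HalfEdge)
    (s : (Γ.strictContraction h).Vert → Bool) :
    (Γ.strictContraction h).cutNumber s = Γ.cutNumber fun v => s (Γ.contractVert h v) :=
  Nat.card_congr (Equiv.subtypeSubtypeEquivSubtype
    (p := fun k : Γ.HalfEdge => k ≠ h ∧ k ≠ Γ.i h)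
    (q := fun k => s (Γ.contractVert h (Γ.a k)) = true ∧
      s (Γ.contractVert h (Γ.a (Γ.i k))) = false)
    fun hk => ne_of_cut (s := fun v => s (Γ.contractVert h v))
      (congrArg s (Γ.contractVert_a_i h).symm) hk)

/-- A colouring for which an edge is monochromatic descends to the contraction of the edge. -/
theorem exists_contract_coloring {Γ : MarkedGraph n} {h : Γ.HalfEdge} {s : Γ.Vert → Bool}
    (hs : s (Γ.a h) = s (Γ.a (Γ.i h))) :
    ∃ s' : (Γ.strictContraction h).Vert → Bool, ∀ v, s' (Γ.contractVert h v) = s v := by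
  refine ⟨Quotient.lift s ?_, fun v => rfl⟩
  rintro v w (rfl | ⟨rfl | rfl, rfl | rfl⟩)
  · rfl
  · rfl
  · exact hs
  · exact hs.symm
  · rfl

theorem IsCut.contract {Γ : MarkedGraph n} {h : Γ.HalfEdge}
    {s : (Γ.strictContraction h).Vert → Bool}
    (hs : Γ.IsCut fun v => s (Γ.contractVert h v)) : (Γ.strictContraction h).IsCut s := by
  refine ⟨fun b => ?_, fun v w e => ?_⟩
  · obtain ⟨v, hv⟩ := hs.surj b
    exact ⟨_, hv⟩
  · obtain ⟨v, rfl⟩ := Γ.contractVert_surjective h v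
    obtain ⟨w, rfl⟩ := Γ.contractVert_surjective h w
    refine Relation.ReflTransGen.lift' (Γ.contractVert h) ?_ _ _ (hs.conn v w e)
    rintro v w ⟨e, hc⟩
    rcases Γ.contractVert_adj h e with e | e
    · change Relation.ReflTransGen _ (Γ.contractVert h v) (Γ.contractVert h w)
      rw [e]
      exact Relation.ReflTransGen.refl
    · exact Relation.ReflTransGen.single ⟨e, hc⟩

/-- A path inside a colour class would need a monochromatic edge, so connected colour classes are
single vertices. -/
theorem IsCut.injective {Γ : MarkedGraph n} {s : Γ.Vert → Bool} (hs : Γ.IsCut s)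
    (hne : ∀ h, s (Γ.a h) ≠ s (Γ.a (Γ.i h))) : Function.Injective s := by
  intro v w e
  have : ∀ w, Relation.ReflTransGen (fun v w => Γ.Adj v w ∧ s v = s w) v w → v = w := by
    intro w hw
    induction hw with
    | refl => rfl
    | tail _ h _ =>
      obtain ⟨⟨k, rfl, rfl⟩, hk⟩ := h
      exact absurd hk (hne k)
  exact this w (hs.conn v w e)

theorem valence_eq_cutNumber {Γ : MarkedGraph n} {s : Γ.Vert → Bool}
    (hs : Function.Injective s) (hne : ∀ h, s (Γ.a h) ≠ s (Γ.a (Γ.i h))) {v : Γ.Vert}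
    (hv : s v = true) : Γ.valence v = Γ.cutNumber s := by
  refine Nat.card_congr (Equiv.subtypeEquivRight fun h => ⟨?_, fun e => hs (e.1.trans hv.symm)⟩)
  rintro rfl
  have := hne h
  rw [hv] at this
  exact ⟨hv, by simpa using this.symm⟩

theorem sideDeg_eq {Γ : MarkedGraph n} {s : Γ.Vert → Bool}
    (hs : Function.Injective s) {v : Γ.Vert}
    (hv : s v = true) : Γ.sideDeg s = Γ.omegaDeg v := by
  have : (Finset.univ.filter fun v => s v = true) = {v} := by
    ext w
    simp only [Finset.mem_filter, Finset.mem_univ, true_and, Finset.mem_singleton]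
    exact ⟨fun e => hs (e.trans hv.symm), fun e => e ▸ hv⟩
  rw [sideDeg, this, Finset.sum_singleton]

theorem two_mul_genus_eq {Γ : MarkedGraph n} {s : Γ.Vert → Bool}
    (hs : Function.Injective s) (hne : ∀ h, s (Γ.a h) ≠ s (Γ.a (Γ.i h))) {v : Γ.Vert}
    (hv : s v = true) : (2 * Γ.genus v : ℝ) = Γ.sideDeg s + 2 - Γ.cutNumber s := by
  rw [sideDeg_eq hs hv, ← valence_eq_cutNumber hs hne hv, omegaDeg]
  ring

/-- The half-edges of a graph without monochromatic edges. -/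
theorem bichromatic_bijective {Γ : MarkedGraph n} {s : Γ.Vert → Bool}
    (hne : ∀ h, s (Γ.a h) ≠ s (Γ.a (Γ.i h))) : Function.Bijective
      fun x : {h // s (Γ.a h) = true ∧ s (Γ.a (Γ.i h)) = false} × Bool =>
        if x.2 then x.1.1 else Γ.i x.1.1 := by
  constructor
  · rintro ⟨⟨h, hh⟩, b⟩ ⟨⟨k, hk⟩, c⟩ e
    cases b <;> cases c <;> simp only [if_true, Bool.false_eq_true, if_false] at e
    · have := congrArg Γ.i e
      simp only [Γ.i_i] at this
      subst this
      rfl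
    · subst e
      simp [hh.2] at hk
    · subst e
      simp [hk.2] at hh
    · subst e
      rfl
  · intro h
    have := hne h
    cases hh : s (Γ.a h)
    · refine ⟨(⟨Γ.i h, ?_⟩, false), ?_⟩
      · rw [hh] at this
        rw [Γ.i_i]
        exact ⟨by simpa using this.symm, hh⟩
      · simp [Γ.i_i]
    · refine ⟨(⟨h, hh, ?_⟩, true), ?_⟩
      · rw [hh] at this
        simpa using this.symm
      · simp

/-- Without monochromatic edges, every half-edge is a crossing one or the opposite of one, so only
the number of edges, the distribution of markings and the two genera matter. The genera are
recovered from the ω-degrees by `two_mul_genus_eq`. -/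
theorem exists_iso_of_cut {Γ Γ' : MarkedGraph n} (hg : Γ.arithGenus = Γ'.arithGenus)
    {s : Γ.Vert → Bool} {s' : Γ'.Vert → Bool} (hs : Function.Bijective s)
    (hs' : Function.Bijective s')
    (hne : ∀ h, s (Γ.a h) ≠ s (Γ.a (Γ.i h))) (hne' : ∀ h, s' (Γ'.a h) ≠ s' (Γ'.a (Γ'.i h)))
    (hd : Γ.sideDeg s = Γ'.sideDeg s') (hm : Γ.sideMarks s = Γ'.sideMarks s')
    (ht : Γ.cutNumber s = Γ'.cutNumber s') :
    ∃ f : Iso Γ Γ', ∀ v, s' (f.vert v) = s v := by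
  let u := (Equiv.ofBijective s hs).trans (Equiv.ofBijective s' hs').symm
  have hu : ∀ v, s' (u v) = s v := fun v =>
    Equiv.apply_symm_apply (Equiv.ofBijective s' hs') (s v)
  let D := Equiv.ofBijective _ (bichromatic_bijective hne)
  let D' := Equiv.ofBijective _ (bichromatic_bijective hne')
  have hD : ∀ x b, D (x, b) = if b then x.1 else Γ.i x.1 := fun x b => rfl
  have hD' : ∀ x b, D' (x, b) = if b then x.1 else Γ'.i x.1 := fun x b => rfl
  -- Parallel edges are interchangeable, so any bijection of crossing half-edges will do.
  obtain ⟨E⟩ := (Finite.card_eq (α := {h // s (Γ.a h) = true ∧ s (Γ.a (Γ.i h)) = false})).1 ht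
  let H := D.symm.trans ((E.prodCongr (Equiv.refl Bool)).trans D')
  have hH : ∀ x b, H (D (x, b)) = D' (E x, b) := fun x b => by simp [H]
  have hgen : ∀ v, s v = true → Γ'.genus (u v) = Γ.genus v := fun v hv => by
    have e := two_mul_genus_eq hs.1 hne hv
    have e' := two_mul_genus_eq hs'.1 hne' ((hu v).trans hv)
    rw [hd, ht, ← e'] at e
    have : (Γ.genus v : ℝ) = Γ'.genus (u v) := by linarith
    exact_mod_cast this.symm
  -- On the other side the same formula is used with the colours exchanged; the equality of
  -- arithmetic genera enters here.
  have hgen' : ∀ v, s v = false → Γ'.genus (u v) = Γ.genus v := fun v hv => by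
    have e := two_mul_genus_eq (s := fun v => !s v) (fun v w e => hs.1 (by simpa using e))
      (by simpa using hne) (v := v) (by simp [hv])
    have e' := two_mul_genus_eq (s := fun v => !s' v) (fun v w e => hs'.1 (by simpa using e))
      (by simpa using hne') (v := u v) (by simp [hu, hv])
    rw [sideDeg_not, cutNumber_not] at e e'
    rw [hg, hd, ht, ← e'] at e
    have : (Γ.genus v : ℝ) = Γ'.genus (u v) := by linarith
    exact_mod_cast this.symm
  refine ⟨⟨u, H, fun k => ?_, fun k => ?_, fun v => ?_, fun j => ?_⟩, hu⟩
  · obtain ⟨⟨x, b⟩, rfl⟩ := D.surjective k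
    rw [hH]
    refine hs'.1 ((hu _).trans ?_)
    rw [hD, hD']
    cases b
    · simp [x.2.2, (E x).2.2]
    · simp [x.2.1, (E x).2.1]
  · obtain ⟨⟨x, b⟩, rfl⟩ := D.surjective k
    have e : Γ.i (D (x, b)) = D (x, !b) := by
      rw [hD, hD]
      cases b <;> simp [Γ.i_i]
    rw [e, hH, hH, hD', hD']
    cases b <;> simp [Γ'.i_i]
  · cases hv : s v
    · exact hgen' v hv
    · exact hgen v hv
  · refine hs'.1 ((hu _).trans ?_)
    have := Finset.ext_iff.1 hm j
    simp only [sideMarks, Finset.mem_filter, Finset.mem_univ, true_and] at this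
    exact Bool.eq_iff_iff.2 this

end MarkedGraph

/-! ### The value of a parameter on a cut -/

variable {g n : ℕ}

/-- The value of a parameter on the subcurve of the vertices coloured `true`. -/
noncomputable def cutSum (φ : Ambient g n) (Γ : StableGraph g n) (s : Γ.1.Vert → Bool) : ℝ :=
  ∑ v with s v = true, extend φ Γ v

theorem cutSum_contract {φ : Ambient g n} (hφ : φ ∈ stabilitySpace g n) (Γ : StableGraph g n)
    (h : Γ.1.HalfEdge) (s : (Γ.contract h).1.Vert → Bool) :
    cutSum φ (Γ.contract h) s = cutSum φ Γ fun v => s (Γ.1.contractVert h v) :=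
  Γ.1.sum_contract_color h _ _ (extend_contract hφ Γ h) s

/-- Monochromatic edges are contracted one at a time, by induction on the number of half-edges; each
contraction preserves the three invariants and the value of φ. -/
theorem exists_bichromatic {φ : Ambient g n} (hφ : φ ∈ stabilitySpace g n) (Γ : StableGraph g n)
    (s : Γ.1.Vert → Bool) (hs : Γ.1.IsCut s) :
    ∃ (Γ' : StableGraph g n) (s' : Γ'.1.Vert → Bool), Γ'.1.IsCut s' ∧
      (∀ h, s' (Γ'.1.a h) ≠ s' (Γ'.1.a (Γ'.1.i h))) ∧ Γ'.1.sideDeg s' = Γ.1.sideDeg s ∧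
      Γ'.1.sideMarks s' = Γ.1.sideMarks s ∧ Γ'.1.cutNumber s' = Γ.1.cutNumber s ∧
      cutSum φ Γ' s' = cutSum φ Γ s := by
  induction hN : Nat.card Γ.1.HalfEdge using Nat.strong_induction_on generalizing Γ with
  | _ N ih =>
    by_cases hne : ∀ h, s (Γ.1.a h) ≠ s (Γ.1.a (Γ.1.i h))
    · exact ⟨Γ, s, hs, hne, rfl, rfl, rfl, rfl⟩
    · simp only [not_forall, not_not] at hne
      obtain ⟨h, hh⟩ := hne
      obtain ⟨s', hs'⟩ := exists_contract_coloring hh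
      obtain rfl : (fun v => s' (Γ.1.contractVert h v)) = s := funext hs'
      obtain ⟨Γ', t, h1, h2, h3, h4, h5, h6⟩ := ih _
        (hN ▸ Γ.1.card_halfEdge_strictContraction_lt h) (Γ.contract h) s' hs.contract rfl
      exact ⟨Γ', t, h1, h2, h3.trans (Γ.1.sideDeg_contract h s'), h4,
        h5.trans (Γ.1.cutNumber_contract h s'), h6.trans (cutSum_contract hφ Γ h s')⟩

/-- The value of a parameter on a connected subcurve with connected complement depends only on
the degree of the dualizing sheaf, the markings and the number of intersection points. -/
theorem cutSum_eq {φ : Ambient g n} (hφ : φ ∈ stabilitySpace g n) {Γ Γ' : StableGraph g n}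
    {s : Γ.1.Vert → Bool} {s' : Γ'.1.Vert → Bool} (hs : Γ.1.IsCut s) (hs' : Γ'.1.IsCut s')
    (hd : Γ.1.sideDeg s = Γ'.1.sideDeg s') (hm : Γ.1.sideMarks s = Γ'.1.sideMarks s')
    (ht : Γ.1.cutNumber s = Γ'.1.cutNumber s') : cutSum φ Γ s = cutSum φ Γ' s' := by
  obtain ⟨Γ₁, s₁, a1, a2, a3, a4, a5, a6⟩ := exists_bichromatic hφ Γ s hs
  obtain ⟨Γ₂, s₂, b1, b2, b3, b4, b5, b6⟩ := exists_bichromatic hφ Γ' s' hs'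
  rw [← a6, ← b6]
  obtain ⟨f, hf⟩ := exists_iso_of_cut (Γ₁.2.2.trans Γ₂.2.2.symm) ⟨a1.injective a2, a1.surj⟩
    ⟨b1.injective b2, b1.surj⟩ a2 b2 (by rw [a3, b3, hd]) (by rw [a4, b4, hm])
    (by rw [a5, b5, ht])
  rw [cutSum, cutSum, Finset.sum_filter, Finset.sum_filter, ← f.vert.sum_comp]
  simp only [hf, extend_iso hφ f]

theorem cutSum_not {φ : Ambient g n} (hφ : φ ∈ stabilitySpaceDeg g n 0) (Γ : StableGraph g n)
    (s : Γ.1.Vert → Bool) : cutSum φ Γ (fun v => !s v) = - cutSum φ Γ s := by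
  rw [cutSum, sum_filter_not, sum_extend hφ, cutSum, zero_sub]

open Classical in
/-- The value of a parameter on subcurves with the given invariants. -/
noncomputable def cutValue (φ : Ambient g n) (w : ℝ) (S : Finset (Fin n)) (t : ℕ) : ℝ :=
  if h : ∃ (Γ : StableGraph g n) (s : Γ.1.Vert → Bool), Γ.1.IsCut s ∧ Γ.1.sideDeg s = w ∧
    Γ.1.sideMarks s = S ∧ Γ.1.cutNumber s = t then cutSum φ h.choose h.choose_spec.choose else 0

theorem cutValue_eq {φ : Ambient g n} (hφ : φ ∈ stabilitySpace g n) {Γ : StableGraph g n}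
    {s : Γ.1.Vert → Bool} (hs : Γ.1.IsCut s) {w : ℝ} {S : Finset (Fin n)} {t : ℕ}
    (hw : Γ.1.sideDeg s = w) (hS : Γ.1.sideMarks s = S) (ht : Γ.1.cutNumber s = t) :
    cutValue φ w S t = cutSum φ Γ s := by
  have h : ∃ (Γ : StableGraph g n) (s : Γ.1.Vert → Bool), Γ.1.IsCut s ∧ Γ.1.sideDeg s = w ∧
    Γ.1.sideMarks s = S ∧ Γ.1.cutNumber s = t := ⟨Γ, s, hs, hw, hS, ht⟩
  rw [cutValue, dif_pos h]
  obtain ⟨h1, h2, h3, h4⟩ := h.choose_spec.choose_spec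
  exact cutSum_eq hφ h1 hs (h2.trans hw.symm) (h3.trans hS.symm) (h4.trans ht.symm)

/-- Exchanging the colours replaces the ω-degree by its complement in `2g - 2`, and the two sides of
a parameter of degree 0 have opposite values. -/
theorem cutValue_compl {φ : Ambient g n} (hφ : φ ∈ stabilitySpaceDeg g n 0) (w : ℝ)
    (S : Finset (Fin n)) (t : ℕ) :
    cutValue φ (2 * (g : ℝ) - 2 - w) Sᶜ t = - cutValue φ w S t := by
  by_cases h : ∃ (Γ : StableGraph g n) (s : Γ.1.Vert → Bool), Γ.1.IsCut s ∧ Γ.1.sideDeg s = w ∧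
    Γ.1.sideMarks s = S ∧ Γ.1.cutNumber s = t
  · obtain ⟨Γ, s, hs, rfl, rfl, rfl⟩ := h
    rw [cutValue_eq hφ.1 hs rfl rfl rfl, ← cutSum_not hφ]
    refine cutValue_eq hφ.1 hs.not ?_ (Γ.1.sideMarks_not s) (Γ.1.cutNumber_not s)
    rw [sideDeg_not, Γ.2.2]
    simp
  -- If no cut realizes the invariants, none realizes the complementary ones either, and both values
  -- are the default 0.
  · have h' : ¬ ∃ (Γ : StableGraph g n) (s : Γ.1.Vert → Bool), Γ.1.IsCut s ∧
        Γ.1.sideDeg s = 2 * (g : ℝ) - 2 - w ∧ Γ.1.sideMarks s = Sᶜ ∧ Γ.1.cutNumber s = t := by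
      rintro ⟨Γ, s, hs, h1, h2, h3⟩
      refine h ⟨Γ, _, hs.not, ?_, ?_, ?_⟩
      · rw [sideDeg_not, Γ.2.2, h1]
        push_cast
        ring
      · rw [sideMarks_not, h2, compl_compl]
      · rw [cutNumber_not, h3]
    rw [cutValue, cutValue, dif_neg h, dif_neg h', neg_zero]

/-! ### Complete loopless graphs and triangles -/

namespace MarkedGraph

variable {n : ℕ}

open Classical in
/-- The markings on a vertex. -/
noncomputable def marksAt (Γ : MarkedGraph n) (v : Γ.Vert) : Finset (Fin n) :=
  Finset.univ.filter fun j => Γ.mark j = v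

theorem mem_marksAt {Γ : MarkedGraph n} {v : Γ.Vert} {j : Fin n} :
    j ∈ Γ.marksAt v ↔ Γ.mark j = v := by
  simp [marksAt]

theorem card_marksAt (Γ : MarkedGraph n) (v : Γ.Vert) : (Γ.marksAt v).card = Γ.numMarks v := by
  classical
  rw [numMarks, Nat.card_eq_fintype_card, Fintype.card_subtype, marksAt]

/-- A graph without loops, in which any two distinct vertices are adjacent. -/
structure IsComplete (Γ : MarkedGraph n) : Prop where
  adj : ∀ v w, v ≠ w → Γ.Adj v w
  loopless : ∀ h, Γ.a h ≠ Γ.a (Γ.i h)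

theorem IsComplete.isConnected {Γ : MarkedGraph n} [Nonempty Γ.Vert] (hΓ : Γ.IsComplete) :
    Γ.IsConnected := by
  refine ⟨inferInstance, fun v w => ?_⟩
  by_cases e : v = w
  · rw [e]
  · exact Relation.ReflTransGen.single (hΓ.adj v w e)

-- Any set of vertices of a complete graph is connected; the second vertex `w` only ensures that
-- both colours occur.
open Classical in
theorem IsComplete.isCut {Γ : MarkedGraph n} (hΓ : Γ.IsComplete) {v w : Γ.Vert} (hvw : v ≠ w) :
    Γ.IsCut fun u => decide (u = v) := by
  refine ⟨fun b => ?_, fun u x e => ?_⟩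
  · cases b
    · exact ⟨w, by simp [hvw.symm]⟩
    · exact ⟨v, by simp⟩
  · by_cases h : u = x
    · rw [h]
    · exact Relation.ReflTransGen.single ⟨hΓ.adj u x h, e⟩

open Classical in
theorem IsComplete.cutNumber {Γ : MarkedGraph n} (hΓ : Γ.IsComplete) (v : Γ.Vert) :
    Γ.cutNumber (fun u => decide (u = v)) = Γ.valence v := by
  refine Nat.card_congr (Equiv.subtypeEquivRight fun h => ?_)
  simp only [decide_eq_true_eq, decide_eq_false_iff_not, and_iff_left_iff_imp]
  rintro rfl
  exact (hΓ.loopless h).symm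

/-- The graph with given vertices and edges. -/
def ofEdges {V E : Type} [Fintype V] [Fintype E] (src tgt : E → V) (genus : V → ℕ)
    (mark : Fin n → V) : MarkedGraph n where
  Vert := V
  HalfEdge := E × Bool
  fintypeVert := inferInstance
  fintypeHalfEdge := inferInstance
  a h := if h.2 then src h.1 else tgt h.1
  i h := (h.1, !h.2)
  i_i h := by simp
  i_ne h e := by simpa using congrArg Prod.snd e
  genus := genus
  mark := mark

theorem valence_ofEdges {V E : Type} [Fintype V] [Fintype E] [DecidableEq V] (src tgt : E → V)
    (genus : V → ℕ) (mark : Fin n → V) (v : V) :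
    (ofEdges src tgt genus mark).valence v =
      ∑ e, ((if src e = v then 1 else 0) + if tgt e = v then 1 else 0) := by
  change Nat.card {h : E × Bool // (if h.2 then src h.1 else tgt h.1) = v} = _
  rw [Nat.card_eq_fintype_card, Fintype.card_subtype, Finset.card_filter, Fintype.sum_prod_type]
  simp only [Fintype.sum_bool, Bool.false_eq_true, if_true, if_false]

/-- The triangle with vertices `0`, `1`, `2`, whose vertices `1` and `2` are joined by `k` edges. -/
def triangle (k : ℕ) (genus : Fin 3 → ℕ) (mark : Fin n → Fin 3) : MarkedGraph n :=
  ofEdges (E := Bool ⊕ Fin k) (Sum.elim (fun _ => 0) fun _ => 1)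
    (Sum.elim (fun b => if b then 1 else 2) fun _ => 2) genus mark

theorem triangle_valence (k : ℕ) (genus : Fin 3 → ℕ) (mark : Fin n → Fin 3) (v : Fin 3) :
    (triangle k genus mark).valence v = if v = 0 then 2 else k + 1 := by
  refine (valence_ofEdges _ _ _ _ v).trans ?_
  rw [Fintype.sum_sum_type]
  fin_cases v <;> simp [add_comm]

theorem triangle_isComplete {k : ℕ} (hk : 1 ≤ k) (genus : Fin 3 → ℕ) (mark : Fin n → Fin 3) :
    (triangle k genus mark).IsComplete := by
  have h01 : (triangle k genus mark).Adj (0 : Fin 3) (1 : Fin 3) := ⟨(Sum.inl true, true), rfl, rfl⟩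
  have h02 : (triangle k genus mark).Adj (0 : Fin 3) (2 : Fin 3) :=
    ⟨(Sum.inl false, true), rfl, rfl⟩
  have h12 : (triangle k genus mark).Adj (1 : Fin 3) (2 : Fin 3) :=
    ⟨(Sum.inr ⟨0, hk⟩, true), rfl, rfl⟩
  refine ⟨fun (v : Fin 3) (w : Fin 3) hvw => ?_, ?_⟩
  · fin_cases v <;> fin_cases w
    exacts [absurd rfl hvw, h01, h02, h01.symm, absurd rfl hvw, h12, h02.symm, h12.symm,
      absurd rfl hvw]
  · rintro ⟨(b | x), c⟩ <;> cases c <;> try cases b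
    all_goals simp [triangle, ofEdges]

theorem triangle_arithGenus (k : ℕ) (genus : Fin 3 → ℕ) (mark : Fin n → Fin 3) :
    (triangle k genus mark).arithGenus = genus 0 + genus 1 + genus 2 + k := by
  have e1 : Nat.card (triangle k genus mark).Edge = k + 2 := by
    refine edge_card _ ?_
    change Nat.card ((Bool ⊕ Fin k) × Bool) = _
    simp
    ring
  have e2 : Nat.card (triangle k genus mark).Vert = 3 := show Nat.card (Fin 3) = 3 by simp
  have e3 : ∑ v, ((triangle k genus mark).genus v : ℤ) = genus 0 + genus 1 + genus 2 :=
    Fin.sum_univ_three _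
  rw [arithGenus, e1, e2, e3]
  push_cast
  ring

end MarkedGraph

/-! ### The triangle relation and additivity -/

variable {g n : ℕ}

theorem extend_eq_cutValue {φ : Ambient g n} (hφ : φ ∈ stabilitySpace g n) (Γ : StableGraph g n)
    (hΓ : Γ.1.IsComplete) {v w : Γ.1.Vert} (hvw : v ≠ w) :
    extend φ Γ v = cutValue φ (Γ.1.omegaDeg v) (Γ.1.marksAt v) (Γ.1.valence v) := by
  classical
  have hinj : (Finset.univ.filter fun u => decide (u = v) = true) = {v} := by
    ext u
    simp
  rw [cutValue_eq hφ (hΓ.isCut hvw) ?_ ?_ (hΓ.cutNumber v), cutSum, hinj, Finset.sum_singleton]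
  · rw [sideDeg, hinj, Finset.sum_singleton]
  · ext j
    simp [sideMarks, marksAt]

/-- Each vertex of a triangle is one side of a cut, and the three values add up to the total degree
0. The valences are 2, `k + 1`, `k + 1`; the last three hypotheses are stability, for which a vertex
of genus 0 needs a marking when its valence is 2. -/
theorem cutValue_triangle {φ : Ambient g n} (hφ : φ ∈ stabilitySpaceDeg g n 0) {k : ℕ}
    (hk : 1 ≤ k) {genus : Fin 3 → ℕ} {mark : Fin n → Fin 3}
    (hg : genus 0 + genus 1 + genus 2 + k = g) (h0 : genus 0 = 0 → ∃ j, mark j = 0)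
    (h1 : genus 1 = 0 → 2 ≤ k ∨ ∃ j, mark j = 1) (h2 : genus 2 = 0 → 2 ≤ k ∨ ∃ j, mark j = 2) :
    cutValue φ (2 * genus 0) {j | mark j = 0} 2 +
      cutValue φ (2 * genus 1 + k - 1) {j | mark j = 1} (k + 1) +
      cutValue φ (2 * genus 2 + k - 1) {j | mark j = 2} (k + 1) = 0 := by
  set T := triangle k genus mark
  have hT : T.IsComplete := triangle_isComplete hk genus mark
  have hv := triangle_valence k genus mark
  have hm : ∀ v : Fin 3, T.marksAt v = ({j | mark j = v} : Finset (Fin n)) := by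
    intro v
    ext j
    refine mem_marksAt.trans ?_
    change mark j = v ↔ _
    simp
  have hpos : ∀ v : Fin 3, (∃ j, mark j = v) → 1 ≤ T.numMarks v := by
    rintro v ⟨j, hj⟩
    exact le_of_le_of_eq (Finset.card_pos.2 ⟨j, mem_marksAt.2 hj⟩) (card_marksAt T v)
  have hst : T.IsStable := by
    have : Nonempty T.Vert := ⟨(0 : Fin 3)⟩
    refine ⟨hT.isConnected, fun (v : Fin 3) hv0 => ?_⟩
    rw [hv v]
    fin_cases v
    · have := hpos 0 (h0 hv0)
      simp only [Fin.zero_eta, if_true]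
      omega
    · rcases h1 hv0 with h | h
      · simp only [Fin.mk_one, one_ne_zero, if_false]
        omega
      · have := hpos 1 h
        simp only [Fin.mk_one, one_ne_zero, if_false]
        omega
    · rcases h2 hv0 with h | h
      · simp only [Fin.reduceFinMk, Fin.reduceEq, if_false]
        omega
      · have := hpos 2 h
        simp only [Fin.reduceFinMk, Fin.reduceEq, if_false]
        omega
  let Γ : StableGraph g n := ⟨T, hst, by
    rw [triangle_arithGenus, ← hg]
    push_cast
    rfl⟩
  have hsum := sum_extend hφ Γ
  have hsum' : extend φ Γ (0 : Fin 3) + extend φ Γ (1 : Fin 3) + extend φ Γ (2 : Fin 3) = 0 :=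
    (Fin.sum_univ_three (fun v : Fin 3 => extend φ Γ v)).symm.trans hsum
  have hd : ∀ v : Fin 3, T.omegaDeg v =
      2 * genus v - 2 + ((if v = 0 then 2 else k + 1 : ℕ) : ℝ) :=
    fun v => congrArg (fun x : ℕ => 2 * (genus v : ℝ) - 2 + (x : ℝ)) (hv v)
  rw [extend_eq_cutValue hφ.1 Γ hT (show (0 : Fin 3) ≠ (1 : Fin 3) by decide),
    extend_eq_cutValue hφ.1 Γ hT (show (1 : Fin 3) ≠ (0 : Fin 3) by decide),
    extend_eq_cutValue hφ.1 Γ hT (show (2 : Fin 3) ≠ (0 : Fin 3) by decide)] at hsum'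
  change cutValue φ (T.omegaDeg _) (T.marksAt _) (T.valence _) +
    cutValue φ (T.omegaDeg _) (T.marksAt _) (T.valence _) +
    cutValue φ (T.omegaDeg _) (T.marksAt _) (T.valence _) = 0 at hsum'
  rw [hd, hd, hd, hm, hm, hm, hv, hv, hv] at hsum'
  rw [← hsum']
  congr 3
  · simp
  · simp only [one_ne_zero, if_false]
    push_cast
    ring
  · simp only [Fin.reduceEq, if_false]
    push_cast
    ring

/-- Moving a piece with two branches across a cut. -/
theorem cutValue_union {φ : Ambient g n} (hφ : φ ∈ stabilitySpaceDeg g n 0) {k a b : ℕ}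
    {S T : Finset (Fin n)} (hk : 1 ≤ k) (hg : a + b + k ≤ g) (hST : Disjoint S T)
    (ha : a = 0 → S.Nonempty) (hb : b = 0 → 2 ≤ k ∨ T.Nonempty)
    (hc : a + b + k = g → 2 ≤ k ∨ S ∪ T ≠ Finset.univ) :
    cutValue φ (2 * (a + b : ℕ) + k - 1) (S ∪ T) (k + 1) =
      cutValue φ (2 * a) S 2 + cutValue φ (2 * b + k - 1) T (k + 1) := by
  have hT : ∀ j ∈ T, j ∉ S := fun j h h' => Finset.disjoint_left.1 hST h' h
  have e0 : ({j | (if j ∈ S then 0 else if j ∈ T then 1 else 2 : Fin 3) = 0} :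
      Finset (Fin n)) = S := by
    ext j
    simp only [Finset.mem_filter, Finset.mem_univ, true_and]
    split_ifs <;> simp <;> tauto
  have e1 : ({j | (if j ∈ S then 0 else if j ∈ T then 1 else 2 : Fin 3) = 1} :
      Finset (Fin n)) = T := by
    ext j
    have := hT j
    simp only [Finset.mem_filter, Finset.mem_univ, true_and]
    split_ifs <;> simp <;> tauto
  have e2 : ({j | (if j ∈ S then 0 else if j ∈ T then 1 else 2 : Fin 3) = 2} :
      Finset (Fin n)) = (S ∪ T)ᶜ := by
    ext j
    simp only [Finset.mem_filter, Finset.mem_univ, true_and, Finset.mem_compl, Finset.mem_union]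
    split_ifs <;> simp <;> tauto
  -- The third vertex takes the remaining genus and markings; the cycles of the triangle contribute
  -- `k` to the genus.
  have key := cutValue_triangle hφ hk (genus := ![a, b, g - (a + b + k)])
    (mark := fun j => if j ∈ S then 0 else if j ∈ T then 1 else 2)
    (by simp; omega) (fun h => ?_) (fun h => ?_) (fun h => ?_)
  · rw [e0, e1, e2] at key
    -- The third vertex is the complement of the first two together, so its value is minus the value
    -- of the union.
    have hw : (2 * ((![a, b, g - (a + b + k)] 2 : ℕ) : ℝ) + k - 1) =
        2 * (g : ℝ) - 2 - (2 * (a + b : ℕ) + k - 1) := by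
      have : (g : ℝ) = a + b + k + (g - (a + b + k) : ℕ) := by exact_mod_cast (by omega)
      rw [this]
      simp
      ring
    rw [hw, cutValue_compl hφ] at key
    simp only [Matrix.cons_val_zero, Matrix.cons_val_one] at key
    linarith
  · obtain ⟨j, hj⟩ := ha h
    exact ⟨j, by simp [hj]⟩
  · rcases hb h with h | ⟨j, hj⟩
    · exact Or.inl h
    · exact Or.inr ⟨j, by simp [hj, hT j hj]⟩
  · have h' : g - (a + b + k) = 0 := h
    rcases hc (by omega) with h | h
    · exact Or.inl h
    · obtain ⟨j, hj⟩ := Finset.nonempty_iff_ne_empty.2 ((Finset.compl_eq_empty_iff _).not.2 h)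
      rw [← e2] at hj
      exact Or.inr ⟨j, (Finset.mem_filter.1 hj).2⟩

/-! ### Cut values at the special graphs -/

/-- The graph `Γ(i,S)` as a stable graph. -/
def sepStable (p : SepIndex g n) : StableGraph g n := ⟨sepGraph p, sepGraph_stable p⟩

/-- The graph `Γ_j` as a stable graph. -/
def nonsepStable (p : NonsepIndex g n) : StableGraph g n := ⟨nonsepGraph p, nonsepGraph_stable p⟩

theorem sepGraph_isComplete (p : SepIndex g n) : (sepGraph p).IsComplete := by
  refine ⟨fun (v : Bool) (w : Bool) h => ⟨v, rfl, ?_⟩, fun h => by cases h <;> simp [sepGraph]⟩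
  exact (by decide : ∀ v w : Bool, v ≠ w → (!v) = w) v w h

theorem nonsepGraph_isComplete (p : NonsepIndex g n) : (nonsepGraph p).IsComplete := by
  refine ⟨fun (v : Bool) (w : Bool) h => ⟨(v, true), rfl, ?_⟩, ?_⟩
  · exact (by decide : ∀ v w : Bool, v ≠ w → (!v) = w) v w h
  · rintro ⟨b, c⟩
    cases b <;> simp [nonsepGraph]

theorem sepGraph_valence (p : SepIndex g n) (v : Bool) : (sepGraph p).valence v = 1 := by
  change Nat.card {h : Bool // h = v} = 1
  simp

theorem nonsepGraph_valence (p : NonsepIndex g n) (v : Bool) : (nonsepGraph p).valence v = 2 := by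
  change Nat.card {h : Bool × Bool // h.1 = v} = 2
  rw [Nat.card_eq_fintype_card]
  cases v <;> rfl

theorem sepGraph_omegaDeg (p : SepIndex g n) : (sepGraph p).omegaDeg true = 2 * p.i - 1 := by
  have e : (sepGraph p).omegaDeg true = 2 * (p.i : ℝ) - 2 + ((sepGraph p).valence true : ℝ) := rfl
  rw [e, sepGraph_valence]
  push_cast
  ring

theorem nonsepGraph_omegaDeg (p : NonsepIndex g n) : (nonsepGraph p).omegaDeg true = 0 := by
  have e : (nonsepGraph p).omegaDeg true =
    2 * ((0 : ℕ) : ℝ) - 2 + ((nonsepGraph p).valence true : ℝ) := rfl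
  rw [e, nonsepGraph_valence]
  push_cast
  ring

theorem extend_sepStable {φ : Ambient g n} (hφ : φ ∈ stabilitySpace g n) (p : SepIndex g n) :
    extend φ (sepStable p) true = cutValue φ (2 * p.i - 1) p.S 1 := by
  have hm : (sepGraph p).marksAt true = p.S := by
    ext j
    refine mem_marksAt.trans ?_
    change decide (j ∈ p.S) = true ↔ _
    simp
  rw [← sepGraph_omegaDeg, ← hm, ← sepGraph_valence p true]
  exact extend_eq_cutValue hφ (sepStable p) (sepGraph_isComplete p) (v := true) (w := false)
    Bool.true_eq_false_eq_False

theorem extend_nonsepStable {φ : Ambient g n} (hφ : φ ∈ stabilitySpace g n)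
    (p : NonsepIndex g n) :
    extend φ (nonsepStable p) true = cutValue φ 0 {p.j} 2 := by
  have hm : (nonsepGraph p).marksAt true = {p.j} := by
    ext j
    refine mem_marksAt.trans ?_
    change decide (j = p.j) = true ↔ _
    simp
  rw [← nonsepGraph_omegaDeg, ← hm, ← nonsepGraph_valence p true]
  exact extend_eq_cutValue hφ (nonsepStable p) (nonsepGraph_isComplete p) (v := true) (w := false)
    Bool.true_eq_false_eq_False

/-! ### Vanishing of the cut values -/

/-- With simple edges all three vertices of the triangle have valence 2, and the relation becomes
additivity in genus and markings jointly. -/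
theorem cutValue_two_union {φ : Ambient g n} (hφ : φ ∈ stabilitySpaceDeg g n 0) {a b : ℕ}
    {S T : Finset (Fin n)} (hg : a + b + 1 ≤ g) (hST : Disjoint S T)
    (ha : a = 0 → S.Nonempty) (hb : b = 0 → T.Nonempty)
    (hc : a + b + 1 = g → S ∪ T ≠ Finset.univ) :
    cutValue φ (2 * (a + b : ℕ)) (S ∪ T) 2 =
      cutValue φ (2 * a) S 2 + cutValue φ (2 * b) T 2 := by
  simpa using cutValue_union hφ le_rfl hg hST ha (fun h => Or.inr (hb h)) fun h => Or.inr (hc h)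

theorem cutValue_two_compl {φ : Ambient g n} (hφ : φ ∈ stabilitySpaceDeg g n 0) {a b : ℕ}
    (h : a + b + 1 = g) (S : Finset (Fin n)) :
    cutValue φ (2 * b) Sᶜ 2 = - cutValue φ (2 * a) S 2 := by
  have hg : (g : ℝ) = a + b + 1 := by exact_mod_cast h.symm
  rw [← cutValue_compl hφ, hg]
  congr 1
  ring

/-- Additivity splits `S` into single markings. For `g = 1` the first marking has to be avoided,
because it has no graph Γ_j. -/
theorem cutValue_two_zero {φ : Ambient g n} (hφ : φ ∈ stabilitySpaceDeg g n 0)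
    (hD : ∀ p : NonsepIndex g n, cutValue φ 0 {p.j} 2 = 0) (hg : 1 ≤ g) {S : Finset (Fin n)}
    (hS : S.Nonempty) (hS' : g = 1 → ∀ j ∈ S, j.val ≠ 0) : cutValue φ 0 S 2 = 0 := by
  induction hS using Finset.Nonempty.cons_induction with
  | singleton j => exact hD ⟨j, hg, fun h => hS' h j (by simp)⟩
  | cons j S hj hS ih =>
    -- When `g = 1` the third vertex has genus 0 and is stable because it carries the first marking.
    have e := cutValue_two_union hφ (a := 0) (b := 0) (S := {j}) (T := S) (by omega)
      (by simpa using hj) (fun _ => by simp) (fun _ => hS) (fun h e => by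
        have h0 : (⟨0, by have := j.isLt; omega⟩ : Fin n) ∈ {j} ∪ S := by rw [e]; simp
        exact hS' (by omega) _ (by simpa using h0) rfl)
    simp only [Nat.cast_zero, mul_zero, add_zero] at e
    rw [Finset.cons_eq_insert, Finset.insert_eq, e,
      hD ⟨j, hg, fun h => hS' h j (by simp)⟩,
      ih fun h k hk => hS' h k (by simp [hk]), add_zero]

/-- Pieces of genus 1 without markings are added one by one. If `a + 1 = g`, the opposite vertex has
genus 0 and valence 2, so a marking must exist. -/
theorem cutValue_two_genus {φ : Ambient g n} (hφ : φ ∈ stabilitySpaceDeg g n 0) {a : ℕ}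
    (ha : 1 ≤ a) (hg : a + 1 ≤ g) (hn : a + 1 = g → 1 ≤ n) :
    cutValue φ (2 * a) ∅ 2 = a * cutValue φ 2 ∅ 2 := by
  induction a, ha using Nat.le_induction with
  | base => simp
  | succ a ha ih =>
    have e := cutValue_two_union hφ (a := a) (b := 1) (S := ∅) (T := ∅) hg
      (by simp) (by omega) (by simp) (fun h e => by
        have : (⟨0, hn h⟩ : Fin n) ∈ (∅ ∪ ∅ : Finset (Fin n)) := by rw [e]; simp
        simp at this)
    rw [Finset.union_empty, ih (by omega) (by omega)] at e
    rw [e]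
    push_cast
    ring_nf

theorem cutValue_two_eq_zero {φ : Ambient g n} (hφ : φ ∈ stabilitySpaceDeg g n 0)
    (hD : ∀ p : NonsepIndex g n, cutValue φ 0 {p.j} 2 = 0) {a : ℕ} {S : Finset (Fin n)}
    (hg : a + 1 ≤ g) (h0 : a = 0 → S.Nonempty) (h1 : a + 1 = g → S ≠ Finset.univ) :
    cutValue φ (2 * a) S 2 = 0 := by
  have hS0 : ∀ {S : Finset (Fin n)}, S.Nonempty → 2 ≤ g → cutValue φ 0 S 2 = 0 :=
    fun hS h2 => cutValue_two_zero hφ hD (by omega) hS (by omega)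
  rcases Nat.eq_zero_or_pos a with rfl | ha
  · simp only [Nat.cast_zero, mul_zero]
    by_cases hg2 : 2 ≤ g
    · exact hS0 (h0 rfl) hg2
    have hg1 : g = 1 := by omega
    -- For `g = 1`, either `S` or its complement avoids the first marking.
    by_cases hfirst : ∀ j ∈ S, j.val ≠ 0
    · exact cutValue_two_zero hφ hD (by omega) (h0 rfl) fun _ => hfirst
    · simp only [not_forall, not_not] at hfirst
      obtain ⟨j, hj, hj0⟩ := hfirst
      have e := cutValue_two_compl hφ (a := 0) (b := 0) (by omega) S
      simp only [Nat.cast_zero, mul_zero] at e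
      rw [cutValue_two_zero hφ hD (by omega)
        (Finset.nonempty_iff_ne_empty.2 ((Finset.compl_eq_empty_iff _).not.2 (h1 (by omega))))] at e
      · linarith
      · intro _ k hk hk0
        rw [Finset.mem_compl] at hk
        exact hk ((Fin.ext (hk0.trans hj0.symm) : k = j) ▸ hj)
  -- Additivity in the genus is played against oddness. Without markings, genus `g - 2` is opposite
  -- to genus 1, which gives `(g - 1) * y = 0` for this value `y`. With markings, genus `g - 1` is
  -- opposite to genus 0 with all markings, where the value is already 0.
  have hy : cutValue φ 2 ∅ 2 = 0 := by
    rcases Nat.eq_zero_or_pos n with rfl | hn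
    · have hag : a + 1 ≠ g := fun h => h1 h (Subsingleton.elim _ _)
      have e := cutValue_two_genus hφ (a := g - 2) (by omega) (by omega) (by omega)
      have e' := cutValue_two_compl hφ (a := g - 2) (b := 1) (by omega) ∅
      rw [Subsingleton.elim (∅ᶜ : Finset (Fin 0)) ∅, e] at e'
      simp only [Nat.cast_one, mul_one] at e'
      have : (((g - 2 : ℕ) : ℝ) + 1) * cutValue φ 2 ∅ 2 = 0 := by linarith
      exact (mul_eq_zero.1 this).resolve_left (by positivity)
    · have e := cutValue_two_genus hφ (a := g - 1) (by omega) (by omega) (fun _ => hn)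
      have e' := cutValue_two_compl hφ (a := g - 1) (b := 0) (by omega) ∅
      rw [Finset.compl_empty, e, Nat.cast_zero, mul_zero,
        hS0 ⟨⟨0, hn⟩, by simp⟩ (by omega)] at e'
      have hg' : ((g - 1 : ℕ) : ℝ) ≠ 0 := by
        rw [Nat.cast_ne_zero]
        omega
      exact (mul_eq_zero.1 (by linarith : ((g - 1 : ℕ) : ℝ) * cutValue φ 2 ∅ 2 = 0)).resolve_left
        hg'
  rcases Finset.eq_empty_or_nonempty S with rfl | hS
  · rw [cutValue_two_genus hφ ha hg, hy, mul_zero]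
    intro h
    by_contra hn
    obtain rfl : n = 0 := by omega
    exact h1 h (Subsingleton.elim _ _)
  -- The piece is split into its markings in genus 0 and its genus without markings.
  · have e := cutValue_two_union hφ (a := 0) (b := a) (S := S) (T := ∅) (by omega) (by simp)
      (fun _ => hS) (by omega) (fun h => by simpa using h1 (by omega))
    rw [zero_add, Finset.union_empty, cutValue_two_genus hφ ha hg, hy, Nat.cast_zero, mul_zero,
      hS0 hS (by omega)] at e
    · simpa using e
    · exact fun _ => Fin.pos hS.choose

/-- With at least three edges a vertex of genus 0 without markings is stable, so all of `a` and `S`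
can be moved across the cut at no cost. The value is thus a constant, and oddness makes it 0. -/
theorem cutValue_many_eq_zero {φ : Ambient g n} (hφ : φ ∈ stabilitySpaceDeg g n 0)
    (hD : ∀ p : NonsepIndex g n, cutValue φ 0 {p.j} 2 = 0) {a k : ℕ} {S : Finset (Fin n)}
    (hk : 2 ≤ k) (hg : a + k ≤ g) : cutValue φ (2 * a + k - 1) S (k + 1) = 0 := by
  have key : ∀ {a : ℕ} {S : Finset (Fin n)}, a + k ≤ g →
      cutValue φ (2 * a + k - 1) S (k + 1) = cutValue φ (k - 1) ∅ (k + 1) := by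
    intro a S hg
    by_cases h0 : a = 0 ∧ S = ∅
    · obtain ⟨rfl, rfl⟩ := h0
      simp
    · have hS : a = 0 → S.Nonempty := fun h =>
        Finset.nonempty_iff_ne_empty.2 fun h' => h0 ⟨h, h'⟩
      have e := cutValue_union hφ (k := k) (a := a) (b := 0) (S := S) (T := ∅) (by omega)
        (by omega) (by simp) hS (fun _ => Or.inl hk) fun _ => Or.inl hk
      rw [cutValue_two_eq_zero hφ hD (by omega) hS (by omega)] at e
      simpa using e
  -- The opposite side has genus `g - k - a`, as `k + 1` parallel edges contribute `k`; both sides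
  -- have the same constant value.
  have e1 := key (a := a) (S := S) hg
  have e2 := key (a := g - k - a) (S := Sᶜ) (by omega)
  have e3 := cutValue_compl hφ (2 * a + k - 1) S (k + 1)
  have hw : 2 * (g : ℝ) - 2 - (2 * a + k - 1) = 2 * ((g - k - a : ℕ) : ℝ) + k - 1 := by
    have : (g : ℝ) = a + k + (g - k - a : ℕ) := by exact_mod_cast (by omega)
    linarith
  rw [hw] at e3
  linarith

/-- The normalization of `SepIndex` admits one side of every separating edge, except when `n = 0`
and both sides have the same genus; there the value equals its own negative. -/
theorem cutValue_one_eq_zero {φ : Ambient g n} (hφ : φ ∈ stabilitySpaceDeg g n 0)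
    (hC : ∀ p : SepIndex g n, cutValue φ (2 * p.i - 1) p.S 1 = 0) {a : ℕ} {S : Finset (Fin n)}
    (hg : a ≤ g) (h0 : a = 0 → 2 ≤ S.card) (h1 : a = g → S.card + 2 ≤ n) :
    cutValue φ (2 * a - 1) S 1 = 0 := by
  have hcard : Sᶜ.card + S.card = n := by
    rw [Finset.card_compl_add_card, Fintype.card_fin]
  have e := cutValue_compl hφ (2 * a - 1) S 1
  have hw : 2 * (g : ℝ) - 2 - (2 * a - 1) = 2 * ((g - a : ℕ) : ℝ) - 1 := by
    rw [Nat.cast_sub hg]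
    ring
  rw [hw] at e
  rcases Nat.eq_zero_or_pos n with rfl | hn
  · rw [Subsingleton.elim Sᶜ S] at e
    rcases lt_trichotomy a (g - a) with h | h | h
    · exact hC ⟨a, S, hg, h0, h1, fun _ => h, fun j => j.elim0⟩
    · rw [← h] at e
      linarith
    · have := hC ⟨g - a, S, by omega, by omega, by omega, by omega, fun j => j.elim0⟩
      linarith
  · by_cases hS : (⟨0, hn⟩ : Fin n) ∈ S
    · exact hC ⟨a, S, hg, h0, h1, by omega, fun j hj => (Fin.ext hj : j = ⟨0, hn⟩) ▸ hS⟩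
    · have := hC ⟨g - a, Sᶜ, by omega, by omega, by omega, by omega,
        fun j hj => (Fin.ext hj : j = ⟨0, hn⟩) ▸ Finset.mem_compl.2 hS⟩
      linarith

/-! ### From graphs with two vertices to all stable graphs -/

theorem MarkedGraph.IsVine.isComplete {Γ : MarkedGraph n} (hΓ : Γ.IsVine) (hc : Γ.IsConnected) :
    Γ.IsComplete := by
  classical
  refine ⟨fun v w hvw => ?_, hΓ.2⟩
  have hcard : Fintype.card Γ.Vert = 2 := by rw [← Nat.card_eq_fintype_card]; exact hΓ.1
  have huniv : ({v, w} : Finset Γ.Vert) = Finset.univ :=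
    Finset.eq_univ_of_card _ (by rw [Finset.card_pair hvw, hcard])
  rcases Relation.ReflTransGen.cases_head (hc.2 v w) with h | ⟨u, ⟨k, rfl, rfl⟩, -⟩
  · exact absurd h hvw
  · have hu : Γ.a (Γ.i k) ∈ ({Γ.a k, w} : Finset Γ.Vert) := by rw [huniv]; simp
    rw [Finset.mem_insert, Finset.mem_singleton] at hu
    rcases hu with hu | hu
    · exact absurd hu.symm (hΓ.2 k)
    · exact ⟨k, rfl, hu⟩

/-- The second vertex of a stable graph with two vertices and no loops. -/
theorem StableGraph.exists_other (Γ : StableGraph g n) (hΓ : Γ.1.IsVine) (v : Γ.1.Vert) :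
    ∃ w, w ≠ v ∧ (∀ u, u = v ∨ u = w) ∧ Γ.1.valence w = Γ.1.valence v ∧ 1 ≤ Γ.1.valence v ∧
      Γ.1.genus v + Γ.1.genus w + Γ.1.valence v = g + 1 ∧
      (Γ.1.marksAt v).card + (Γ.1.marksAt w).card = n := by
  classical
  have hcomp := hΓ.isComplete Γ.2.1.1
  have hcard : Fintype.card Γ.1.Vert = 2 := by rw [← Nat.card_eq_fintype_card]; exact hΓ.1
  obtain ⟨w, hw⟩ : ∃ w, w ≠ v := by
    have : Nontrivial Γ.1.Vert := Fintype.one_lt_card_iff_nontrivial.1 (by omega)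
    exact exists_ne v
  have huniv : (Finset.univ : Finset Γ.1.Vert) = {v, w} :=
    (Finset.eq_univ_of_card _ (by rw [Finset.card_pair hw.symm, hcard])).symm
  have hor : ∀ u, u = v ∨ u = w := fun u => by
    have hu : u ∈ ({v, w} : Finset Γ.1.Vert) := huniv ▸ Finset.mem_univ u
    simpa using hu
  have hval : Γ.1.valence w = Γ.1.valence v := by
    rw [← hcomp.cutNumber w, ← hcomp.cutNumber v, ← cutNumber_not]
    congr 1
    ext u
    rcases hor u with rfl | rfl
    · simp [hw.symm]
    · simp [hw]
  refine ⟨w, hw, hor, hval, ?_, ?_, ?_⟩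
  · obtain ⟨k, hk, -⟩ := hcomp.adj v w hw.symm
    have : Nonempty {h // Γ.1.a h = v} := ⟨⟨k, hk⟩⟩
    exact Nat.card_pos
  · have e := Γ.1.sum_omegaDeg
    rw [Γ.2.2, huniv, Finset.sum_pair hw.symm, omegaDeg, omegaDeg, hval] at e
    have : (Γ.1.genus v + Γ.1.genus w + Γ.1.valence v : ℝ) = g + 1 := by
      push_cast at e
      linarith
    exact_mod_cast this
  · have : (Γ.1.marksAt v)ᶜ = Γ.1.marksAt w := by
      ext j
      rw [Finset.mem_compl, mem_marksAt, mem_marksAt]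
      rcases hor (Γ.1.mark j) with hu | hu
      · simp [hu, hw.symm]
      · simp [hu, hw]
    rw [← this, Finset.card_add_card_compl, Fintype.card_fin]

theorem extend_vine_eq_zero {φ : Ambient g n} (hφ : φ ∈ stabilitySpaceDeg g n 0)
    (hC : ∀ p : SepIndex g n, cutValue φ (2 * p.i - 1) p.S 1 = 0)
    (hD : ∀ p : NonsepIndex g n, cutValue φ 0 {p.j} 2 = 0) (Γ : StableGraph g n)
    (hΓ : Γ.1.IsVine) (v : Γ.1.Vert) : extend φ Γ v = 0 := by
  have hcomp := hΓ.isComplete Γ.2.1.1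
  obtain ⟨w, hw, -, hval, hval0, hgen, hmark⟩ := Γ.exists_other hΓ v
  have sv := Γ.2.1.2 v
  have sw := Γ.2.1.2 w
  rw [← card_marksAt] at sv sw
  rw [hval] at sw
  rw [extend_eq_cutValue hφ.1 Γ hcomp hw.symm, omegaDeg]
  generalize Γ.1.valence v = t at *
  obtain ⟨k, rfl⟩ : ∃ k, t = k + 1 := ⟨t - 1, by omega⟩
  have hd : 2 * (Γ.1.genus v : ℝ) - 2 + (k + 1 : ℕ) = 2 * Γ.1.genus v + k - 1 := by
    push_cast
    ring
  rw [hd]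
  -- The number of edges is `k + 1`; stability of both vertices supplies the conditions on the
  -- markings.
  rcases (by omega : k = 0 ∨ k = 1 ∨ 2 ≤ k) with rfl | rfl | hk
  · simpa using cutValue_one_eq_zero hφ hC (a := Γ.1.genus v) (S := Γ.1.marksAt v) (by omega)
      (by omega) (by omega)
  · simpa using cutValue_two_eq_zero hφ hD (a := Γ.1.genus v) (S := Γ.1.marksAt v) (by omega)
      (fun h => Finset.card_pos.1 (by have := sv h; omega)) (fun h e => by
        have := sw (by omega)
        rw [e, Finset.card_univ, Fintype.card_fin] at hmark
        omega)
  · exact cutValue_many_eq_zero hφ hD hk (by omega)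

/-- By induction φ vanishes on every contraction, so its sum over each fibre of each contraction is
0. Except for graphs with one vertex, and those with two vertices and no loops, this forces φ to
vanish on the graph itself. -/
theorem extend_eq_zero {φ : Ambient g n} (hφ : φ ∈ stabilitySpaceDeg g n 0)
    (hC : ∀ p : SepIndex g n, cutValue φ (2 * p.i - 1) p.S 1 = 0)
    (hD : ∀ p : NonsepIndex g n, cutValue φ 0 {p.j} 2 = 0) (Γ : StableGraph g n)
    (v : Γ.1.Vert) : extend φ Γ v = 0 := by
  classical
  induction hN : Nat.card Γ.1.HalfEdge using Nat.strong_induction_on generalizing Γ with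
  | _ N ih =>
    have hcon : ∀ (h : Γ.1.HalfEdge) (q : Quotient (Γ.1.contractSetoid h)),
        ∑ v with Γ.1.contractVert h v = q, extend φ Γ v = 0 := fun h q => by
      refine Eq.trans ?_ ((extend_contract hφ.1 Γ h q).symm.trans (ih _
        (hN ▸ Γ.1.card_halfEdge_strictContraction_lt h) (Γ.contract h) q rfl))
      exact Finset.sum_congr (by ext; simp) fun _ _ => rfl
    have hnot : ∀ h u, ¬ Γ.1.IsEnd h u → extend φ Γ u = 0 := fun h u hu => by
      have e := hcon h (Γ.1.contractVert h u)
      have : (Finset.univ.filter fun v => Γ.1.contractVert h v = Γ.1.contractVert h u) = {u} := by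
        ext v
        simp [contractVert_eq, hu]
      rwa [this, Finset.sum_singleton] at e
    have hpair : ∀ h, Γ.1.a h ≠ Γ.1.a (Γ.1.i h) →
        extend φ Γ (Γ.1.a h) + extend φ Γ (Γ.1.a (Γ.1.i h)) = 0 := fun h hne => by
      have e := hcon h (Γ.1.contractVert h (Γ.1.a h))
      have : (Finset.univ.filter fun v => Γ.1.contractVert h v =
          Γ.1.contractVert h (Γ.1.a h)) = {Γ.1.a h, Γ.1.a (Γ.1.i h)} := by
        ext v
        simp only [contractVert_eq, IsEnd, Finset.mem_filter, Finset.mem_univ, true_and,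
          Finset.mem_insert, Finset.mem_singleton]
        tauto
      rwa [this, Finset.sum_pair hne] at e
    by_cases hloop : ∀ h, Γ.1.a h ≠ Γ.1.a (Γ.1.i h)
    swap
    -- Contracting a loop identifies no vertices, so every fibre is a single vertex.
    · simp only [not_forall, not_not] at hloop
      obtain ⟨h, hh⟩ := hloop
      have e := hcon h (Γ.1.contractVert h v)
      have : (Finset.univ.filter fun u => Γ.1.contractVert h u = Γ.1.contractVert h v) = {v} := by
        ext u
        simp only [contractVert_eq, IsEnd, ← hh, or_self, Finset.mem_filter, Finset.mem_univ,
          true_and, Finset.mem_singleton]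
        constructor
        · rintro (rfl | ⟨rfl, rfl⟩) <;> rfl
        · exact Or.inl
      rwa [this, Finset.sum_singleton] at e
    by_cases hone : ∀ u, u = v
    · have e := sum_extend hφ Γ
      rwa [Fintype.sum_eq_single v fun u hu => absurd (hone u) hu] at e
    simp only [not_forall] at hone
    obtain ⟨u, huv⟩ := hone
    by_cases htwo : ∀ w, w = u ∨ w = v
    · refine extend_vine_eq_zero hφ hC hD Γ ⟨?_, hloop⟩ v
      have : (Finset.univ : Finset Γ.1.Vert) = {u, v} := by
        ext w
        simp [htwo w]
      rw [Nat.card_eq_fintype_card, ← Finset.card_univ, this, Finset.card_pair huv]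
    simp only [not_forall, not_or] at htwo
    obtain ⟨w, hwu, hwv⟩ := htwo
    by_contra hv
    -- A vertex with nonzero value is an endpoint of every edge, so the first edge on any path
    -- leaving `x` leads to `v`.
    have hend : ∀ x y, x ≠ y → x ≠ v → ∃ h, Γ.1.a h = x ∧ Γ.1.a (Γ.1.i h) = v := by
      intro x y hxy hxv
      rcases Relation.ReflTransGen.cases_head (Γ.2.1.1.2 x y) with h | ⟨z, ⟨k, rfl, rfl⟩, -⟩
      · exact absurd h hxy
      · refine ⟨k, rfl, ?_⟩
        by_contra hz
        refine hv (hnot k v ?_)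
        rintro (e | e)
        · exact hxv e.symm
        · exact hz e.symm
    obtain ⟨h, hu, hv1⟩ := hend u w (Ne.symm hwu) huv
    -- The vertex `w` is not on the edge from `u` to `v`, so its value is 0; the edge from `w` to
    -- `v` then gives 0 at `v`.
    obtain ⟨k, hw, hv2⟩ := hend w u hwu hwv
    have e1 := hpair k (hloop k)
    rw [hw, hv2, hnot h w (by rintro (e | e) <;> simp_all), zero_add] at e1
    exact hv e1

theorem eq_zero_of_components {φ : Ambient g n} (hφ : φ ∈ stabilitySpaceDeg g n 0)
    (hC : ∀ p : SepIndex g n, φ (sepClass p) = 0)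
    (hD : ∀ p : NonsepIndex g n, φ (nonsepClass p) = 0) : φ = 0 := by
  funext C v
  rw [← extend_out hφ.1]
  refine extend_eq_zero hφ (fun p => ?_) (fun p => ?_) _ _
  · rw [← extend_sepStable hφ.1]
    exact congrFun (hC p) _
  · rw [← extend_nonsepStable hφ.1]
    exact congrFun (hD p) _

/-! ### Boundary twists -/

open Classical in
/-- A function on the vertices of all graphs that is compatible with isomorphisms and strict
contractions defines an element of the stability space. -/
theorem mem_stabilitySpace_of_natural (F : ∀ Γ : MarkedGraph n, Γ.Vert → ℝ)
    (hiso : ∀ {Γ Γ' : MarkedGraph n} (f : Iso Γ Γ') (v : Γ.Vert), F Γ' (f.vert v) = F Γ v)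
    (hcon : ∀ (Γ : MarkedGraph n) (h : Γ.HalfEdge) (q : Quotient (Γ.contractSetoid h)),
      F (Γ.strictContraction h) q = ∑ v with Γ.contractVert h v = q, F Γ v) :
    (fun Γ => F Γ.graph : Ambient g n) ∈ stabilitySpace g n := by
  refine ⟨fun Γ α v => hiso α v, fun Γ₁ Γ₂ c v => ?_⟩
  have e := hiso c.iso (c.iso.vert.symm v)
  rw [Equiv.apply_symm_apply] at e
  refine e.trans ((hcon _ _ _).trans ?_)
  convert (c.sum_eq _ v).symm

/-- The half-edge `h` is the only one that leads from the vertices coloured `true` by some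
colouring to the other ones, and the former have genus `p.i` and markings `p.S`. -/
def Separates (p : SepIndex g n) (Γ : MarkedGraph n) (h : Γ.HalfEdge) : Prop :=
  ∃ s : Γ.Vert → Bool, (∀ k, (s (Γ.a k) = true ∧ s (Γ.a (Γ.i k)) = false) ↔ k = h) ∧
    Γ.sideMarks s = p.S ∧ Γ.sideDeg s = 2 * p.i - 1

theorem Separates.iso {p : SepIndex g n} {Γ Γ' : MarkedGraph n} (f : Iso Γ Γ') {h : Γ.HalfEdge}
    (hh : Separates p Γ h) : Separates p Γ' (f.half h) := by
  obtain ⟨s, h1, h2, h3⟩ := hh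
  refine ⟨fun v => s (f.vert.symm v), fun k => ?_, ?_, ?_⟩
  · obtain ⟨k, rfl⟩ := f.half.surjective k
    rw [← f.i_comm, ← f.a_comm, ← f.a_comm]
    simp only [Equiv.symm_apply_apply]
    rw [h1, f.half.apply_eq_iff_eq]
  · rw [← h2]
    ext j
    simp [sideMarks, ← f.mark_comm]
  · rw [← h3, sideDeg, sideDeg, Finset.sum_filter, Finset.sum_filter, ← f.vert.sum_comp]
    simp [f.omegaDeg_eq]

theorem separates_iso_iff (p : SepIndex g n) {Γ Γ' : MarkedGraph n} (f : Iso Γ Γ')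
    (h : Γ.HalfEdge) : Separates p Γ' (f.half h) ↔ Separates p Γ h := by
  refine ⟨fun hh => ?_, Separates.iso f⟩
  have := hh.iso f.symm
  rwa [show f.symm.half (f.half h) = h from f.half.symm_apply_apply h] at this

/-- A colouring of the contraction pulls back; conversely, the only crossing half-edge `k` survives
the contraction, so the contracted edge is monochromatic and the colouring descends. -/
theorem separates_contract_iff (p : SepIndex g n) (Γ : MarkedGraph n) (h : Γ.HalfEdge)
    (k : (Γ.strictContraction h).HalfEdge) :
    Separates p (Γ.strictContraction h) k ↔ Separates p Γ k.1 := by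
  constructor
  · rintro ⟨s, h1, h2, h3⟩
    refine ⟨fun v => s (Γ.contractVert h v), fun l => ⟨fun hl => ?_, ?_⟩, h2, ?_⟩
    · have hne := ne_of_cut (s := fun v => s (Γ.contractVert h v))
        (congrArg s (Γ.contractVert_a_i h).symm) hl
      exact congrArg Subtype.val ((h1 ⟨l, hne⟩).1 hl)
    · rintro rfl
      exact (h1 k).2 rfl
    · rw [← h3, sideDeg_contract]
  · rintro ⟨s, h1, h2, h3⟩
    have hs : s (Γ.a h) = s (Γ.a (Γ.i h)) := by
      by_contra hne
      have e1 := h1 h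
      have e2 := h1 (Γ.i h)
      rw [Γ.i_i] at e2
      have n1 := k.2.1
      have n2 := k.2.2
      cases h3 : s (Γ.a h) <;> cases h4 : s (Γ.a (Γ.i h)) <;> simp_all
    obtain ⟨s', hs'⟩ := exists_contract_coloring hs
    obtain rfl : (fun v => s' (Γ.contractVert h v)) = s := funext hs'
    refine ⟨s', fun l => (h1 l.1).trans Subtype.ext_iff.symm, h2, ?_⟩
    rw [← h3, sideDeg_contract]

open Classical in
/-- The multidegree of the line bundle of the boundary component `C(i,S)`, up to sign. -/
noncomputable def twist (p : SepIndex g n) (Γ : MarkedGraph n) (v : Γ.Vert) : ℝ :=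
  ∑ h, if Separates p Γ h then
    ((if Γ.a h = v then 1 else 0) - if Γ.a (Γ.i h) = v then 1 else 0) else 0

theorem twist_iso (p : SepIndex g n) {Γ Γ' : MarkedGraph n} (f : Iso Γ Γ') (v : Γ.Vert) :
    twist p Γ' (f.vert v) = twist p Γ v := by
  classical
  refine (f.half.sum_comp _).symm.trans (Finset.sum_congr rfl fun h _ => ?_)
  refine if_congr (separates_iso_iff p f h) ?_ rfl
  rw [← f.i_comm, ← f.a_comm, ← f.a_comm]
  simp only [f.vert.apply_eq_iff_eq]

-- Contraction makes the two endpoints of the removed edge coincide, so its half-edges contribute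
-- nothing to the pushforward; all other half-edges correspond.
open Classical in
theorem twist_contract (p : SepIndex g n) (Γ : MarkedGraph n) (h : Γ.HalfEdge)
    (q : Quotient (Γ.contractSetoid h)) :
    twist p (Γ.strictContraction h) q = ∑ v with Γ.contractVert h v = q, twist p Γ v := by
  have hind : ∀ x : Γ.Vert, (∑ v with Γ.contractVert h v = q, if x = v then (1 : ℝ) else 0) =
      if Γ.contractVert h x = q then 1 else 0 := fun x => by
    simp [Finset.sum_ite_eq]
  have e1 : ∑ v with Γ.contractVert h v = q, twist p Γ v = ∑ k, if Separates p Γ k then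
      ((if Γ.contractVert h (Γ.a k) = q then (1 : ℝ) else 0) -
        if Γ.contractVert h (Γ.a (Γ.i k)) = q then 1 else 0) else 0 := by
    simp only [twist]
    rw [Finset.sum_comm]
    refine Finset.sum_congr rfl fun k _ => ?_
    by_cases hk : Separates p Γ k
    · simp only [if_pos hk]
      rw [Finset.sum_sub_distrib, hind, hind]
    · simp only [if_neg hk, Finset.sum_const_zero]
  rw [e1, ← Finset.sum_filter_of_ne (p := fun k => k ≠ h ∧ k ≠ Γ.i h),
    Finset.sum_subtype (p := fun k => k ≠ h ∧ k ≠ Γ.i h) _ (by simp)]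
  · refine Finset.sum_congr rfl fun k _ => ?_
    refine (if_congr (separates_contract_iff p Γ h k) ?_ rfl)
    congr 1 <;> congr 1
  · intro k _ hk
    constructor
    · rintro rfl
      simp [contractVert_a_i] at hk
    · rintro rfl
      simp [contractVert_a_i, Γ.i_i] at hk

theorem sum_twist (p : SepIndex g n) (Γ : MarkedGraph n) : ∑ v, twist p Γ v = 0 := by
  classical
  simp only [twist]
  rw [Finset.sum_comm]
  refine Finset.sum_eq_zero fun h _ => ?_
  split_ifs
  · rw [Finset.sum_sub_distrib]
    simp
  · exact Finset.sum_const_zero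

theorem SepIndex.ext' {p q : SepIndex g n} (h : p.i = q.i) (h' : p.S = q.S) : p = q := by
  cases p
  cases q
  simp only at h h'
  subst h h'
  rfl

theorem sepGraph_sideDeg (q : SepIndex g n) :
    (sepGraph q).sideDeg (fun v : Bool => v) = 2 * q.i - 1 :=
  (sideDeg_eq (Γ := sepGraph q) (s := fun v : Bool => v) (v := true) (fun _ _ e => e) rfl).trans
    (sepGraph_omegaDeg q)

theorem sepGraph_sideMarks (q : SepIndex g n) :
    (sepGraph q).sideMarks (fun v : Bool => v) = q.S := by
  ext j
  refine Finset.mem_filter.trans ?_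
  change _ ∧ decide (j ∈ q.S) = true ↔ _
  simp

theorem separates_sepGraph_true {p q : SepIndex g n} :
    Separates p (sepGraph q) true ↔ q = p := by
  constructor
  · rintro ⟨s, h1, h2, h3⟩
    obtain ⟨e1, e2⟩ := (h1 true).2 rfl
    obtain rfl : s = fun v : Bool => v := by
      funext v
      cases v
      · exact e2
      · exact e1
    rw [sepGraph_sideMarks] at h2
    rw [sepGraph_sideDeg] at h3
    refine SepIndex.ext' ?_ h2
    have : (q.i : ℝ) = p.i := by linarith
    exact_mod_cast this
  · rintro rfl
    refine ⟨fun v : Bool => v, fun (k : Bool) => ?_, sepGraph_sideMarks q, sepGraph_sideDeg q⟩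
    change (k = true ∧ (!k) = false) ↔ k = true
    simp

/-- Read from its other end, the edge belongs to the complementary pair. That pair is not an
admissible index, since the first marking lies in both `p.S` and `q.S`, or, if `n = 0`, since `p.i`
and `q.i` are both less than half of `g`. -/
theorem not_separates_sepGraph_false {p q : SepIndex g n} :
    ¬ Separates p (sepGraph q) false := by
  rintro ⟨s, h1, h2, h3⟩
  obtain ⟨e1, e2⟩ := (h1 false).2 rfl
  have hs : Function.Injective fun v => !s v := fun (v : Bool) (w : Bool) e => by
    have e' : s v = s w := by simpa using e
    match v, w with
    | true, true => rfl
    | false, false => rfl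
    | true, false => exact absurd (e2.symm.trans (e'.trans e1)) (by simp)
    | false, true => exact absurd (e1.symm.trans (e'.trans e2)) (by simp)
  have hd := (sepGraph q).sideDeg_not s
  have h4 : (!s (true : Bool)) = true := by
    have e2 : s (true : Bool) = false := e2
    rw [e2]
    rfl
  rw [sideDeg_eq hs h4, sepGraph_omegaDeg, (sepGraph_stable q).2, h3] at hd
  have hg : q.i + p.i = g := by
    have : (q.i + p.i : ℝ) = g := by
      push_cast at hd
      linarith
    exact_mod_cast this
  rcases Nat.eq_zero_or_pos n with hn | hn
  · have := p.lt_of_unmarked hn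
    have := q.lt_of_unmarked hn
    omega
  · have hp := p.first_mem ⟨0, hn⟩ rfl
    have hq := q.first_mem ⟨0, hn⟩ rfl
    rw [← h2] at hp
    have hp' : s (decide ((⟨0, hn⟩ : Fin n) ∈ q.S)) = true := (Finset.mem_filter.1 hp).2
    rw [decide_eq_true hq] at hp'
    simp [hp'] at h4

open Classical in
theorem twist_sepGraph (p q : SepIndex g n) :
    twist p (sepGraph q) true = if q = p then 1 else 0 := by
  have e : twist p (sepGraph q) true = ∑ h : Bool, if Separates p (sepGraph q) h then
    ((if h = true then (1 : ℝ) else 0) - if (!h) = true then 1 else 0) else 0 := by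
    refine Finset.sum_congr rfl fun h _ => ?_
    congr 2 <;> congr 1
  rw [e, Fintype.sum_bool, if_neg not_separates_sepGraph_false]
  simp [separates_sepGraph_true]

/-- The parallel half-edge crosses whenever the given one does, so neither is the only crossing one.
-/
theorem twist_nonsepGraph (p : SepIndex g n) (q : NonsepIndex g n) (v : Bool) :
    twist p (nonsepGraph q) v = 0 := by
  classical
  refine Finset.sum_eq_zero fun h _ => if_neg ?_
  rintro ⟨s, h1, -, -⟩
  obtain ⟨b, c⟩ := h
  have := (h1 (b, !c)).1 ((h1 (b, c)).2 rfl)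
  simpa using congrArg Prod.snd this

instance (g n : ℕ) : Finite (SepIndex g n) :=
  Finite.of_injective
    (fun p : SepIndex g n => ((⟨p.i, Nat.lt_succ_of_le p.i_le⟩, p.S) : Fin (g + 1) × Finset (Fin n)))
    fun p q e => by
      simp only [Prod.mk.injEq, Fin.mk.injEq] at e
      exact SepIndex.ext' e.1 e.2

theorem NonsepIndex.ext' {p q : NonsepIndex g n} (h : p.j = q.j) : p = q := by
  cases p
  cases q
  simp only at h
  subst h
  rfl

instance (g n : ℕ) : Finite (NonsepIndex g n) :=
  Finite.of_injective (fun p : NonsepIndex g n => p.j) fun _ _ e => NonsepIndex.ext' e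

/-! ### Parameters with prescribed components -/

/-- A rational component with two nodes has ω-degree 0, and for `g = 1` the first marking lies on
the other vertex. Hence subtracting the canonical parameter does not disturb the value at the marked
rational vertex of Γ_j. -/
theorem canonicalParameter_nonsepClass [Fact (2 < 2 * g + n)] (d : ℝ) (p : NonsepIndex g n) :
    canonicalParameter g n d (nonsepClass p) ((nonsepStable p).isoRep.vert true) = 0 := by
  have e1 := (nonsepStable p).isoRep.omegaDeg_eq true
  have e2 := fun j => (nonsepStable p).isoRep.sectionDeg_eq j true
  have e3 := nonsepGraph_omegaDeg p
  by_cases hg : 2 ≤ g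
  · simp only [canonicalParameter, hg, dite_true]
    exact mul_eq_zero_of_right _ (e1.trans e3)
  · simp only [canonicalParameter, hg, dite_false]
    refine mul_eq_zero_of_right _ ((e2 _).trans (if_neg ?_))
    intro h
    have h' := of_decide_eq_true h
    have := p.one_le
    exact p.ne_first (by omega) (congrArg Fin.val h').symm

open Classical in
theorem sectionDeg_nonsepGraph (p q : NonsepIndex g n) :
    (nonsepGraph q).sectionDeg p.j true = if p = q then 1 else 0 := by
  refine if_congr ?_ rfl rfl
  change decide (p.j = q.j) = true ↔ _
  rw [decide_eq_true_eq]
  exact ⟨NonsepIndex.ext', congrArg _⟩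

/-- The submodule of parameters of degree zero. -/
noncomputable def zeroSpace (g n : ℕ) : Submodule ℝ (Ambient g n) where
  carrier := {φ | φ ∈ stabilitySpaceDeg g n 0}
  add_mem' := by
    rintro φ ψ ⟨h1, h2⟩ ⟨h3, h4⟩
    refine ⟨add_mem h1 h3, fun Γ => ?_⟩
    simp [Finset.sum_add_distrib, h2, h4]
  zero_mem' := ⟨zero_mem _, fun Γ => by simp⟩
  smul_mem' := by
    rintro r φ ⟨h1, h2⟩
    refine ⟨Submodule.smul_mem _ _ h1, fun Γ => ?_⟩
    simp [← Finset.mul_sum, h2]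

/-- The value of a parameter at a vertex. -/
def evalAt (C : GraphClass g n) (v : C.graph.Vert) : Ambient g n →ₗ[ℝ] ℝ where
  toFun φ := φ C v
  map_add' _ _ := rfl
  map_smul' _ _ := rfl

/-- The system is triangular: sections first realize the values at the Γ_j, then twists, which
vanish there, correct the values at the Γ(i,S). -/
theorem exists_components [Fact (2 < 2 * g + n)] (c : SepIndex g n → ℝ)
    (d : NonsepIndex g n → ℝ) : ∃ φ ∈ stabilitySpaceDeg g n 0,
      (∀ p, φ (sepClass p) ((sepStable p).isoRep.vert true) = c p) ∧
      ∀ q, φ (nonsepClass q) ((nonsepStable q).isoRep.vert true) = d q := by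
  classical
  let _ : Fintype (SepIndex g n) := Fintype.ofFinite _
  let _ : Fintype (NonsepIndex g n) := Fintype.ofFinite _
  let σ : NonsepIndex g n → Ambient g n := fun q =>
    (fun Γ => Γ.graph.sectionDeg q.j) - canonicalParameter g n 1
  have hσ : ∀ q, σ q ∈ zeroSpace g n := fun q =>
    ⟨Submodule.sub_mem _ (mem_stabilitySpace_of_natural (fun Γ => Γ.sectionDeg q.j)
      (fun f v => f.sectionDeg_eq _ v) fun Γ h => Γ.sectionDeg_contract h _)
      (canonicalParameter_mem g n 1).1, fun Γ => by
        simp only [σ, Pi.sub_apply, Finset.sum_sub_distrib, sum_sectionDeg,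
          canonicalParameter_sum, sub_self]⟩
  let τ : SepIndex g n → Ambient g n := fun p Γ => twist p Γ.graph
  have hτ : ∀ p, τ p ∈ zeroSpace g n := fun p =>
    ⟨mem_stabilitySpace_of_natural (twist p) (twist_iso p) (twist_contract p),
      fun Γ => sum_twist p _⟩
  have hτp : ∀ p q, τ p (sepClass q) ((sepStable q).isoRep.vert true) = if q = p then 1 else 0 :=
    fun p q => (twist_iso p (sepStable q).isoRep true).trans (twist_sepGraph p q)
  have hτq : ∀ p q, τ p (nonsepClass q) ((nonsepStable q).isoRep.vert true) = 0 :=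
    fun p q => (twist_iso p (nonsepStable q).isoRep true).trans (twist_nonsepGraph p q true)
  have hσq : ∀ p q, σ p (nonsepClass q) ((nonsepStable q).isoRep.vert true) =
      if p = q then 1 else 0 := fun p q => by
    have e1 := canonicalParameter_nonsepClass 1 q
    have e2 := ((nonsepStable q).isoRep.sectionDeg_eq p.j true).trans (sectionDeg_nonsepGraph p q)
    refine (congrArg₂ (· - ·) e2 e1).trans (sub_zero _)
  obtain ⟨ψ, hψ⟩ : ∃ ψ, ψ = ∑ q, d q • σ q := ⟨_, rfl⟩
  have hψ0 : ψ ∈ zeroSpace g n :=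
    hψ ▸ Submodule.sum_mem _ fun q _ => Submodule.smul_mem _ _ (hσ q)
  refine ⟨ψ + ∑ p, (c p - ψ (sepClass p) ((sepStable p).isoRep.vert true)) • τ p,
    (zeroSpace g n).add_mem hψ0
      (Submodule.sum_mem _ fun p _ => Submodule.smul_mem _ _ (hτ p)), fun p => ?_, fun q => ?_⟩
  · change evalAt _ _ (ψ + ∑ p', _ • τ p') = _
    rw [map_add, map_sum, Finset.sum_eq_single p]
    · change ψ _ _ + (c p - ψ _ _) * τ p (sepClass p) ((sepStable p).isoRep.vert true) = _
      rw [hτp, if_pos rfl, mul_one]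
      exact add_sub_cancel _ _
    · intro p' _ hp'
      exact mul_eq_zero_of_right _ ((hτp p' p).trans (if_neg hp'.symm))
    · exact fun h => absurd (Finset.mem_univ _) h
  · change evalAt _ _ (ψ + ∑ p', _ • τ p') = _
    rw [map_add, hψ, map_sum, map_sum, Finset.sum_eq_single q, Finset.sum_eq_zero, add_zero]
    · change d q * σ q (nonsepClass q) ((nonsepStable q).isoRep.vert true) = _
      rw [hσq, if_pos rfl, mul_one]
    · intro p' _
      exact mul_eq_zero_of_right _ (hτq p' q)
    · intro q' _ hq'
      exact mul_eq_zero_of_right _ ((hσq q' q).trans (if_neg hq'))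
    · exact fun h => absurd (Finset.mem_univ _) h

/-! ### The affine isomorphism -/

theorem MarkedGraph.IsVine.ext {Γ : MarkedGraph n} (hΓ : Γ.IsVine) {u w : Γ.Vert → ℝ}
    (h : ∑ x, u x = ∑ x, w x) (v : Γ.Vert) (hv : u v = w v) : u = w := by
  classical
  have hcard : Fintype.card Γ.Vert = 2 := by rw [← Nat.card_eq_fintype_card]; exact hΓ.1
  have : Nontrivial Γ.Vert := Fintype.one_lt_card_iff_nontrivial.1 (by omega)
  obtain ⟨x, hx⟩ := exists_ne v
  have huniv : (Finset.univ : Finset Γ.Vert) = {v, x} :=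
    (Finset.eq_univ_of_card _ (by rw [Finset.card_pair hx.symm, hcard])).symm
  rw [huniv, Finset.sum_pair hx.symm, Finset.sum_pair hx.symm, hv] at h
  funext y
  have hy : y ∈ ({v, x} : Finset Γ.Vert) := huniv ▸ Finset.mem_univ y
  rw [Finset.mem_insert, Finset.mem_singleton] at hy
  rcases hy with rfl | rfl
  · exact hv
  · linarith

open Classical in
/-- A function of sum zero on two vertices is determined by its value at one of them. -/
noncomputable def MarkedGraph.IsVine.evalEquiv {Γ : MarkedGraph n} (hΓ : Γ.IsVine) (v : Γ.Vert) :
    Γ.degreeZero ≃ₗ[ℝ] ℝ :=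
  LinearEquiv.ofBijective ((LinearMap.proj v).comp Γ.degreeZero.subtype) <| by
    constructor
    · intro u w h
      exact Subtype.ext (hΓ.ext (u.2.trans w.2.symm) v h)
    · intro r
      have hcard : Fintype.card Γ.Vert = 2 := by rw [← Nat.card_eq_fintype_card]; exact hΓ.1
      refine ⟨⟨fun x => if x = v then r else -r, ?_⟩, if_pos rfl⟩
      change ∑ x, (if x = v then r else -r) = 0
      have e : ∀ x, (if x = v then r else -r) = (if x = v then 2 * r else 0) - r := fun x => by
        split_ifs <;> ring
      simp only [e, Finset.sum_sub_distrib, Finset.sum_ite_eq', Finset.mem_univ, if_true,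
        Finset.sum_const, Finset.card_univ, hcard]
      simp

theorem sub_mem_zero {d : ℝ} {φ ψ : Ambient g n} (hφ : φ ∈ stabilitySpaceDeg g n d)
    (hψ : ψ ∈ stabilitySpaceDeg g n d) : φ - ψ ∈ stabilitySpaceDeg g n 0 :=
  ⟨Submodule.sub_mem _ hφ.1 hψ.1, fun Γ => by
    simp [Finset.sum_sub_distrib, hφ.2, hψ.2]⟩

theorem add_mem_deg {d : ℝ} {φ ψ : Ambient g n} (hφ : φ ∈ stabilitySpaceDeg g n 0)
    (hψ : ψ ∈ stabilitySpaceDeg g n d) : φ + ψ ∈ stabilitySpaceDeg g n d :=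
  ⟨Submodule.add_mem _ hφ.1 hψ.1, fun Γ => by
    simp [Finset.sum_add_distrib, hφ.2, hψ.2]⟩

theorem sum_direction {d : ℝ} {φ : Ambient g n} (hφ : φ ∈ (stabilitySpaceDeg g n d).direction)
    (Γ : GraphClass g n) : ∑ v, φ Γ v = 0 := by
  -- Differences of points describe the direction only of a nonempty affine subspace; that of the
  -- empty one is `⊥`.
  rcases (stabilitySpaceDeg g n d : Set (Ambient g n)).eq_empty_or_nonempty with h | h
  · rw [AffineSubspace.coe_eq_bot_iff] at h
    rw [h, AffineSubspace.direction_bot, Submodule.mem_bot] at hφ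
    simp [hφ]
  · rw [AffineSubspace.mem_direction_iff_eq_vsub h] at hφ
    obtain ⟨φ₁, h1, φ₂, h2, rfl⟩ := hφ
    exact (sub_mem_zero h1 h2).2 Γ

theorem eq_of_components {d : ℝ} {φ ψ : Ambient g n} (hφ : φ ∈ stabilitySpaceDeg g n d)
    (hψ : ψ ∈ stabilitySpaceDeg g n d) (hC : ∀ p : SepIndex g n, φ (sepClass p) = ψ (sepClass p))
    (hD : ∀ p : NonsepIndex g n, φ (nonsepClass p) = ψ (nonsepClass p)) : φ = ψ :=
  sub_eq_zero.1 (eq_zero_of_components (sub_mem_zero hφ hψ) (fun p => sub_eq_zero.2 (hC p))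
    fun p => sub_eq_zero.2 (hD p))

/-- The affine map `(p_C ⊕ p_D) ∘ ρ^d`. -/
noncomputable def componentMap (g n : ℕ) [Fact (2 < 2 * g + n)] (d : ℝ) :
    stabilitySpaceDeg g n d →ᵃ[ℝ] CSpace g n × DSpace g n where
  toFun φ := (projC g n (restrictVine g n d φ), projD g n (restrictVine g n d φ))
  linear :=
    { toFun := fun φ => (fun p => ⟨φ.1 (sepClass p), sum_direction φ.2 _⟩,
        fun p => ⟨φ.1 (nonsepClass p), sum_direction φ.2 _⟩)
      map_add' := fun _ _ => rfl
      map_smul' := fun _ _ => rfl }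
  map_vadd' φ w := by
    refine Prod.ext (funext fun p => Subtype.ext ?_) (funext fun p => Subtype.ext ?_)
    · exact add_sub_assoc (w.1 (sepClass p)) (φ.1 (sepClass p)) _
    · exact add_sub_assoc (w.1 (nonsepClass p)) (φ.1 (nonsepClass p)) _

theorem componentMap_bijective (g n : ℕ) [Fact (2 < 2 * g + n)] (d : ℝ) :
    Function.Bijective (componentMap g n d) := by
  constructor
  · intro φ ψ h
    obtain ⟨hC, hD⟩ := Prod.ext_iff.1 h
    refine Subtype.ext (eq_of_components φ.2 ψ.2 (fun p => ?_) fun p => ?_)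
    · exact sub_left_injective (congrArg Subtype.val (congrFun hC p))
    · exact sub_left_injective (congrArg Subtype.val (congrFun hD p))
  · rintro ⟨c, e⟩
    obtain ⟨φ, hφ, h1, h2⟩ := exists_components
      (fun p => (c p).1 ((sepStable p).isoRep.vert true))
      (fun q => (e q).1 ((nonsepStable q).isoRep.vert true))
    refine ⟨⟨φ + canonicalParameter g n d, add_mem_deg hφ (canonicalParameter_mem g n d)⟩,
      Prod.ext (funext fun p => Subtype.ext ?_) (funext fun p => Subtype.ext ?_)⟩
    · refine (add_sub_cancel_right (φ (sepClass p)) _).trans ?_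
      exact (sepClass_isVine p).ext ((hφ.2 _).trans (c p).2.symm) _ (h1 p)
    · refine (add_sub_cancel_right (φ (nonsepClass p)) _).trans ?_
      exact (nonsepClass_isVine p).ext ((hφ.2 _).trans (e p).2.symm) _ (h2 p)

theorem componentMap_canonicalPoint (g n : ℕ) [Fact (2 < 2 * g + n)] (d : ℝ) :
    componentMap g n d (canonicalPoint g n d) = 0 :=
  Prod.ext (funext fun _ => Subtype.ext (sub_self _)) (funext fun _ => Subtype.ext (sub_self _))

/-- Automorphism invariance makes the coordinates independent of the identification with the
representative, so they may be read off through any isomorphism. -/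
theorem restrictVine_iso [Fact (2 < 2 * g + n)] {d : ℝ} (φ : stabilitySpaceDeg g n d)
    (C : VineClass g n) {Γ : MarkedGraph n} (f f' : Iso Γ C.1.graph) (v : Γ.Vert) :
    (restrictVine g n d φ C).1 (f.vert v) = (restrictVine g n d φ C).1 (f'.vert v) := by
  have h := (sub_mem_zero φ.2 (canonicalParameter_mem g n d)).1.1 C.1 (f'.symm.trans f) (f'.vert v)
  have e : (f'.symm.trans f).vert (f'.vert v) = f.vert v :=
    congrArg f.vert (f'.vert.symm_apply_apply v)
  rw [e] at h
  exact h

/-! ### Counting graphs with one edge -/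

/-- An isomorphism must respect the first marking, which lies on `true` in both graphs, so it cannot
exchange the two vertices. -/
theorem sepClass_injective (hn : 1 ≤ n) : Function.Injective (sepClass (g := g) (n := n)) := by
  intro p q h
  obtain ⟨f⟩ : Nonempty (Iso (sepGraph p) (sepGraph q)) := Quotient.exact h
  have hmark : ∀ j, f.vert (decide (j ∈ p.S)) = decide (j ∈ q.S) := f.mark_comm
  have h0 := hmark ⟨0, hn⟩
  rw [decide_eq_true (p.first_mem ⟨0, hn⟩ rfl), decide_eq_true (q.first_mem ⟨0, hn⟩ rfl)] at h0
  refine SepIndex.ext' ?_ (Finset.ext fun j => ?_)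
  · have := f.genus_comm true
    rw [h0] at this
    exact this.symm
  · have hj := hmark j
    constructor
    · intro hp
      rw [decide_eq_true hp, h0] at hj
      exact of_decide_eq_true hj.symm
    · intro hq
      rw [decide_eq_true hq, ← h0] at hj
      exact of_decide_eq_true (f.vert.injective hj)

/-- The graph with one vertex and one loop. -/
def loopGraph (g n : ℕ) : MarkedGraph n where
  Vert := Unit
  HalfEdge := Bool
  fintypeVert := inferInstance
  fintypeHalfEdge := inferInstance
  a _ := ()
  i b := !b
  i_i b := by simp
  i_ne b := by simp
  genus _ := g - 1
  mark _ := ()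

theorem loopGraph_stable (hg : 2 ≤ g) :
    (loopGraph g n).IsStable ∧ (loopGraph g n).arithGenus = g := by
  refine ⟨⟨⟨⟨()⟩, fun v w => ?_⟩, fun v hv => ?_⟩, ?_⟩
  · obtain rfl : v = w := rfl
    exact Relation.ReflTransGen.refl
  · have : g - 1 = 0 := hv
    omega
  · have e1 : Nat.card (loopGraph g n).Edge = 1 :=
      edge_card _ (show Nat.card Bool = 2 * 1 by simp)
    have e2 : Nat.card (loopGraph g n).Vert = 1 := show Nat.card Unit = 1 by simp
    have e3 : (∑ v, ((loopGraph g n).genus v : ℤ)) = (g - 1 : ℕ) :=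
      Fintype.sum_unique (fun _ : Unit => ((g - 1 : ℕ) : ℤ))
    rw [arithGenus, e1, e2, e3]
    push_cast [Nat.cast_sub (by omega : 1 ≤ g)]
    ring

theorem MarkedGraph.Iso.card_edge {Γ Γ' : MarkedGraph n} (f : Iso Γ Γ') :
    Nat.card Γ.Edge = Nat.card Γ'.Edge := by
  have e := Nat.card_congr f.half
  rw [card_halfEdge, card_halfEdge] at e
  omega

theorem exists_iso_sepGraph (hn : 1 ≤ n) (Γ : StableGraph g n) (hΓ : Γ.1.IsVine)
    (he : Nat.card Γ.1.Edge = 1) : ∃ p : SepIndex g n, Nonempty (Iso (sepGraph p) Γ.1) := by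
  classical
  have hcomp := hΓ.isComplete Γ.2.1.1
  set v := Γ.1.mark ⟨0, hn⟩ with hv
  obtain ⟨w, hw, hor, hval, hval0, hgen, hmark⟩ := Γ.exists_other hΓ v
  have hval1 : Γ.1.valence v = 1 := by
    have e := Γ.1.sum_valence
    have huniv : (Finset.univ : Finset Γ.1.Vert) = {v, w} := by
      ext u
      simpa using hor u
    rw [card_halfEdge, he, huniv, Finset.sum_pair hw.symm, hval] at e
    omega
  have sv := Γ.2.1.2 v
  have sw := Γ.2.1.2 w
  rw [← card_marksAt] at sv sw
  rw [hval] at sw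
  -- The vertex of the first marking plays the role of `true`; stability of the two vertices gives
  -- the bounds on the number of markings.
  let p : SepIndex g n := ⟨Γ.1.genus v, Γ.1.marksAt v, by omega, fun h => by have := sv h; omega,
    fun h => by have := sw (by omega); omega, by omega, fun j hj => by
      rw [mem_marksAt, hv]
      exact congrArg _ (Fin.ext hj)⟩
  have hs : Function.Injective fun u => decide (u = v) := fun u x e => by
    rcases hor u with rfl | rfl <;> rcases hor x with rfl | rfl <;> simp_all
  have hne : ∀ h : Bool, h ≠ !h := by decide
  obtain ⟨f, -⟩ := exists_iso_of_cut (Γ := sepGraph p)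
    ((sepGraph_stable p).2.trans Γ.2.2.symm)
    (s := fun u : Bool => u) (s' := fun u => decide (u = v))
    Function.bijective_id ⟨hs, (hcomp.isCut hw.symm).surj⟩ hne
    (fun h e => hcomp.loopless h (hs e))
    (by
      rw [sepGraph_sideDeg, sideDeg_eq hs (v := v) (by simp), omegaDeg, hval1]
      push_cast
      ring)
    (by
      rw [sepGraph_sideMarks]
      ext j
      simp [sideMarks, p, mem_marksAt])
    (by
      rw [hcomp.cutNumber, hval1, ← sepGraph_valence p true]
      exact (valence_eq_cutNumber (Γ := sepGraph p) (s := fun u : Bool => u) (v := true)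
        Function.injective_id hne rfl).symm)
  exact ⟨p, ⟨f⟩⟩

theorem StableGraph.eq_or_eq_of_card_edge (Γ : StableGraph g n) (he : Nat.card Γ.1.Edge = 1)
    (h : Γ.1.HalfEdge) :
    (∀ k, k = h ∨ k = Γ.1.i h) ∧ ∀ v, v = Γ.1.a h ∨ v = Γ.1.a (Γ.1.i h) := by
  classical
  have hcard : Fintype.card Γ.1.HalfEdge = 2 := by
    rw [← Nat.card_eq_fintype_card, card_halfEdge, he]
  have huniv : ({h, Γ.1.i h} : Finset Γ.1.HalfEdge) = Finset.univ :=
    Finset.eq_univ_of_card _ (by rw [Finset.card_pair (Γ.1.i_ne h).symm, hcard])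
  have hor : ∀ k, k = h ∨ k = Γ.1.i h := fun k => by
    have : k ∈ ({h, Γ.1.i h} : Finset Γ.1.HalfEdge) := by rw [huniv]; simp
    simpa using this
  refine ⟨hor, fun v => ?_⟩
  rcases Relation.ReflTransGen.cases_head (Γ.2.1.1.2 v (Γ.1.a h)) with e | ⟨w, ⟨k, rfl, -⟩, -⟩
  · exact Or.inl e
  · rcases hor k with rfl | rfl
    · exact Or.inl rfl
    · exact Or.inr rfl

theorem exists_iso_loopGraph (Γ : StableGraph g n) (he : Nat.card Γ.1.Edge = 1)
    (h : Γ.1.HalfEdge) (hh : Γ.1.a h = Γ.1.a (Γ.1.i h)) :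
    Nonempty (Iso (loopGraph g n) Γ.1) := by
  classical
  obtain ⟨hor, hv⟩ := Γ.eq_or_eq_of_card_edge he h
  simp only [← hh, or_self] at hv
  have hgen : Γ.1.genus (Γ.1.a h) + 1 = g := by
    have e := Γ.2.2
    have huniv : (Finset.univ : Finset Γ.1.Vert) = {Γ.1.a h} := by
      ext v
      simpa using hv v
    rw [arithGenus, he, Nat.card_eq_fintype_card, ← Finset.card_univ, huniv, Finset.sum_singleton,
      Finset.card_singleton] at e
    push_cast at e
    omega
  refine ⟨⟨⟨fun _ => Γ.1.a h, fun _ => (), fun _ => rfl, fun v => (hv v).symm⟩,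
    ⟨fun b : Bool => if b then h else Γ.1.i h, fun k => decide (k = h), fun (b : Bool) => ?_,
      fun k => ?_⟩, fun b => (hv _).symm, fun (b : Bool) => ?_, fun v => ?_,
      fun j => (hv _).symm⟩⟩
  · cases b
    · exact decide_eq_false (Γ.1.i_ne h)
    · exact decide_eq_true rfl
  · rcases hor k with rfl | rfl
    · simp
    · simp [Γ.1.i_ne h]
  · cases b
    · change (if (!false) = true then h else Γ.1.i h) =
        Γ.1.i (if false = true then h else Γ.1.i h)
      simp [Γ.1.i_i]
    · change (if (!true) = true then h else Γ.1.i h) =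
        Γ.1.i (if true = true then h else Γ.1.i h)
      simp
  · change Γ.1.genus (Γ.1.a h) = g - 1
    omega

/-- The isomorphism classes of graphs with one edge: the loop and the graphs `Γ(i,S)`. -/
theorem numBoundaryDivisors_eq (hg : 2 ≤ g) (hn : 1 ≤ n) :
    numBoundaryDivisors g n = Nat.card (SepIndex g n) + 1 := by
  have hedge : ∀ Γ : StableGraph g n, Nat.card Γ.cls.graph.Edge = Nat.card Γ.1.Edge :=
    fun Γ => Γ.isoRep.card_edge.symm
  let L : StableGraph g n := ⟨loopGraph g n, loopGraph_stable hg⟩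
  have hL : Nat.card L.cls.graph.Edge = 1 :=
    (hedge L).trans (edge_card _ (show Nat.card Bool = 2 * 1 by simp))
  have hS : ∀ p : SepIndex g n, Nat.card (sepClass p).graph.Edge = 1 := fun p =>
    (hedge (sepStable p)).trans (edge_card _ (show Nat.card Bool = 2 * 1 by simp))
  -- The loop is the image of `none` and accounts for the difference between `N` and the number of
  -- pairs.
  let F : Option (SepIndex g n) → {Γ : GraphClass g n // Nat.card Γ.graph.Edge = 1} :=
    fun o => o.elim ⟨L.cls, hL⟩ fun p => ⟨sepClass p, hS p⟩
  have hLS : ∀ p : SepIndex g n, L.cls ≠ sepClass p := fun p e => by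
    obtain ⟨f⟩ : Nonempty (Iso (loopGraph g n) (sepGraph p)) := Quotient.exact e
    have : Nat.card Unit = Nat.card Bool := Nat.card_congr f.vert
    simp at this
  have hF : Function.Bijective F := by
    constructor
    · rintro (_ | p) (_ | q) e
      · rfl
      · exact absurd (congrArg Subtype.val e) (hLS q)
      · exact absurd (congrArg Subtype.val e).symm (hLS p)
      · exact congrArg some (sepClass_injective hn (congrArg Subtype.val e))
    · rintro ⟨C, hC⟩
      have hout : StableGraph.cls (Quotient.out C) = C := Quotient.out_eq C
      by_cases hloop : ∃ h, C.graph.a h = C.graph.a (C.graph.i h)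
      · obtain ⟨h, hh⟩ := hloop
        obtain ⟨f⟩ := exists_iso_loopGraph (Quotient.out C) hC h hh
        refine ⟨none, Subtype.ext ?_⟩
        exact Eq.trans (Quotient.sound ⟨f⟩ : L.cls = StableGraph.cls (Quotient.out C)) hout
      · simp only [not_exists] at hloop
        have hcard : Nat.card C.graph.Vert = 2 := by
          classical
          obtain ⟨h⟩ : Nonempty C.graph.HalfEdge := by
            refine (Nat.card_pos_iff.1 ?_).1
            rw [card_halfEdge, hC]
            norm_num
          have hv : ∀ v : C.graph.Vert, v = C.graph.a h ∨ v = C.graph.a (C.graph.i h) :=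
            ((Quotient.out C).eq_or_eq_of_card_edge hC h).2
          have huniv : (Finset.univ : Finset C.graph.Vert) =
              {C.graph.a h, C.graph.a (C.graph.i h)} := by
            ext v
            simp [hv v]
          rw [Nat.card_eq_fintype_card, ← Finset.card_univ, huniv, Finset.card_pair (hloop h)]
        obtain ⟨p, ⟨f⟩⟩ := exists_iso_sepGraph hn (Quotient.out C) ⟨hcard, hloop⟩ hC
        refine ⟨some p, Subtype.ext ?_⟩
        exact Eq.trans (Quotient.sound ⟨f⟩ : sepClass p = StableGraph.cls (Quotient.out C)) hout
  rw [numBoundaryDivisors, ← Nat.card_congr (Equiv.ofBijective F hF), Finite.card_option]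

/-- The graphs `Γ_j` for `g ≥ 2`. -/
def nonsepIndexEquiv (hg : 2 ≤ g) : NonsepIndex g n ≃ Fin n where
  toFun p := p.j
  invFun j := ⟨j, by omega, by omega⟩
  left_inv _ := rfl
  right_inv _ := rfl

end UniversalStability

theorem corollary3p6 (g n : ℕ) [Fact (2 < 2 * g + n)] :
    (∀ d : ℝ, ∃ e : stabilitySpaceDeg g n d ≃ᵃ[ℝ] CSpace g n × DSpace g n,
      e (canonicalPoint g n d) = 0 ∧
      ∀ φ, e φ = (projC g n (restrictVine g n d φ), projD g n (restrictVine g n d φ))) ∧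
    (∀ d : ℝ, ∀ φ ∈ stabilitySpaceDeg g n d, ∀ ψ ∈ stabilitySpaceDeg g n d,
      (∀ p : SepIndex g n, φ (sepClass p) = ψ (sepClass p)) →
      (∀ p : NonsepIndex g n, φ (nonsepClass p) = ψ (nonsepClass p)) → φ = ψ) ∧
    (2 ≤ g → 1 ≤ n →
      ∃ (ι : SepIndex g n ≃ Fin (numBoundaryDivisors g n - 1))
        (e : stabilitySpaceDeg g n ((g : ℝ) - 1) ≃ᵃ[ℝ]
          (Fin (numBoundaryDivisors g n - 1) → ℝ) × (Fin n → ℝ)),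
        ∀ φ : stabilitySpaceDeg g n ((g : ℝ) - 1),
          (∀ (p : SepIndex g n) (f : Iso (sepGraph p) (sepClass p).graph),
            (e φ).1 (ι p) =
              (projC g n (restrictVine g n ((g : ℝ) - 1) φ) p).1 (f.vert true)) ∧
          (∀ (p : NonsepIndex g n) (f : Iso (nonsepGraph p) (nonsepClass p).graph),
            (e φ).2 p.j =
              (projD g n (restrictVine g n ((g : ℝ) - 1) φ) p).1 (f.vert true))) := by
  refine ⟨fun d => ⟨AffineEquiv.ofBijective (componentMap_bijective g n d),
    componentMap_canonicalPoint g n d, fun φ => rfl⟩,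
    fun d φ hφ ψ hψ => eq_of_components hφ hψ, fun hg hn => ?_⟩
  let ι : SepIndex g n ≃ Fin (numBoundaryDivisors g n - 1) :=
    (Finite.equivFin _).trans (finCongr (by rw [numBoundaryDivisors_eq hg hn]; rfl))
  let E : (CSpace g n × DSpace g n) ≃ₗ[ℝ]
      (Fin (numBoundaryDivisors g n - 1) → ℝ) × (Fin n → ℝ) :=
    ((LinearEquiv.piCongrRight fun p : SepIndex g n =>
        (sepClass_isVine p).evalEquiv ((sepStable p).isoRep.vert true)).trans
      (LinearEquiv.funCongrLeft ℝ ℝ ι.symm)).prodCongr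
    ((LinearEquiv.piCongrRight fun p : NonsepIndex g n =>
        (nonsepClass_isVine p).evalEquiv ((nonsepStable p).isoRep.vert true)).trans
      (LinearEquiv.funCongrLeft ℝ ℝ (nonsepIndexEquiv hg).symm))
  refine ⟨ι, (AffineEquiv.ofBijective (componentMap_bijective g n _)).trans E.toAffineEquiv,
    fun φ => ⟨fun p f => ?_, fun p f => ?_⟩⟩
  -- After reindexing, the component is taken at `ι.symm (ι p)` and through `isoRep`;
  -- `restrictVine_iso` replaces the latter by the given `f`.
  · change (restrictVine g n _ φ ⟨sepClass (ι.symm (ι p)), _⟩).1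
      ((sepStable (ι.symm (ι p))).isoRep.vert true) = _
    rw [ι.symm_apply_apply]
    exact restrictVine_iso φ ⟨sepClass p, sepClass_isVine p⟩ _ f _
  · exact restrictVine_iso φ ⟨nonsepClass p, nonsepClass_isVine p⟩ (nonsepStable p).isoRep f true
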